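/- Let $(B^n,g_B)$ be a connected Riemannian manifold and $(F^d,g_F)$ a nonempty semi-Riemannian manifold of dimension $d\ge 1$ whose scalar curvature is a constant $\lambda_F$ (manifolds are smooth and without boundary). Let $f,h\in C^\infty(B)$ with $f>0$, and let $B\times_f F$ be the warped product, that is, $B\times F$ with the metric $\overline g=\pi^*g_B+(f\circ\pi)^2\sigma^*g_F$, where $\pi:B\times F\to B$ and $\sigma:B\times F\to F$ are the projections. Suppose that $B\times_f F$ is a gradient Yamabe soliton with potential function $h\circ\pi$ and soliton constant $\rho\in\mathbb R$, that is, $$(S_{\overline g}-\rho)\,\overline g=\mathrm{Hess}_{\overline g}(h\circ\pi),$$ where $S_{\overline g}$ denotes the scalar curvature of $\overline g$, and suppose that the scalar curvature of $g_B$ satisfies $S_B\ge\rho-\lambda_F/f^2$ on $B$. If $f$ attains its maximum on $B$, then $f$ is equal to a constant $c>0$, and hence $B\times_f F$ is the standard semi-Riemannian product of $(B,g_B)$ and $(F,c^2g_F)$, i.e. $\overline g=\pi^*g_B+\sigma^*(c^2g_F)$. -/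

import Mathlib

open scoped Manifold ContDiff

set_option maxSynthPendingDepth 3

noncomputable section

/-! ### Tensor calculus for a metric `G` on a finite-dimensional vector space -/

section LocalGeometry

variable {E : Type*} [NormedAddCommGroup E] [NormedSpace ℝ E]

/-- The Christoffel symbols `Γ_y(u, v)` of a field `G` of nondegenerate symmetric bilinear forms:
`G_y(Γ_y(u, v), z) = (1/2) (D_u G (v, z) + D_v G (u, z) - D_z G (u, v))`. -/
def christoffel (G : E → E →L[ℝ] E →L[ℝ] ℝ) (y : E) : E →L[ℝ] E →L[ℝ] E :=
  let D : E →L[ℝ] E →L[ℝ] E →L[ℝ] ℝ := fderiv ℝ G y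
  let transpose : (E →L[ℝ] E →L[ℝ] ℝ) →L[ℝ] (E →L[ℝ] E →L[ℝ] ℝ) :=
    (ContinuousLinearMap.flipₗᵢ ℝ E E ℝ).toContinuousLinearEquiv
  (1 / 2 : ℝ) • (ContinuousLinearMap.compL ℝ E (E →L[ℝ] ℝ) E (G y).inverse) ∘L
    (D + D.flip - transpose ∘L D.flip : E →L[ℝ] E →L[ℝ] E →L[ℝ] ℝ)

/-- The defining formula of the Christoffel symbols, in vector form: `christoffel G y u v` is
`(1/2) G_y⁻¹` of the covector `z ↦ D_u G (v, z) + D_v G (u, z) - D_z G (u, v)`. -/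
theorem christoffel_apply (G : E → E →L[ℝ] E →L[ℝ] ℝ) (y u v : E) :
    christoffel G y u v = (1 / 2 : ℝ) • (G y).inverse
      (fderiv ℝ G y u v + fderiv ℝ G y v u - ((fderiv ℝ G y).flip u).flip v) := rfl

/-- The linear map `u ↦ R_y(u, v) w`, where
`R(u, v) w = (D_u Γ)(v, w) - (D_v Γ)(u, w) + Γ(u, Γ(v, w)) - Γ(v, Γ(u, w))`. -/
def curvatureMap (G : E → E →L[ℝ] E →L[ℝ] ℝ) (y v w : E) : E →ₗ[ℝ] E where
  toFun u := fderiv ℝ (christoffel G) y u v w - fderiv ℝ (christoffel G) y v u w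
    + christoffel G y u (christoffel G y v w) - christoffel G y v (christoffel G y u w)
  map_add' u u' := by simp; abel
  map_smul' c u := by simp [smul_sub, smul_add]

/-- The Ricci tensor `Ric_y(v, w) = tr (u ↦ R_y(u, v) w)`. -/
def ricciTensor (G : E → E →L[ℝ] E →L[ℝ] ℝ) (y : E) : E →ₗ[ℝ] E →ₗ[ℝ] ℝ :=
  LinearMap.mk₂ ℝ (fun v w => LinearMap.trace ℝ E (curvatureMap G y v w))
    (fun v v' w => by
      rw [← map_add]; congr 1; ext u; simp [curvatureMap]; abel)
    (fun c v w => by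
      rw [← map_smul]; congr 1; ext u; simp [curvatureMap, smul_sub, smul_add])
    (fun v w w' => by
      rw [← map_add]; congr 1; ext u; simp [curvatureMap]; abel)
    (fun c v w => by
      rw [← map_smul]; congr 1; ext u; simp [curvatureMap, smul_sub, smul_add])

/-- The scalar curvature at `y`: the trace of the Ricci tensor with respect to `G_y`, that is,
the trace of the endomorphism `v ↦ G_y⁻¹ (Ric_y(v, ·))`. -/
def localScalarCurvature [FiniteDimensional ℝ E] (G : E → E →L[ℝ] E →L[ℝ] ℝ) (y : E) : ℝ :=
  LinearMap.trace ℝ E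
    ((G y).inverse.toLinearMap ∘ₗ LinearMap.toContinuousLinearMap.toLinearMap ∘ₗ ricciTensor G y)

/-- The Hessian `(∇ du)_y(v, w) = D²u_y(v, w) - Du_y(Γ_y(v, w))`. -/
def localHessian (G : E → E →L[ℝ] E →L[ℝ] ℝ) (u : E → ℝ) (y v w : E) : ℝ :=
  fderiv ℝ (fderiv ℝ u) y v w - fderiv ℝ u y (christoffel G y v w)

end LocalGeometry

/-! ### Semi-Riemannian metrics on manifolds -/

section Manifolds

variable {E : Type*} [NormedAddCommGroup E] [NormedSpace ℝ E]
  {H : Type*} [TopologicalSpace H]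

/-- The expression, in the preferred chart `φ` at `x₀`, of a field `g` of bilinear forms on the
tangent spaces: the pullback `((φ⁻¹)^* g)_y(u, v) = g_{φ⁻¹ y}(d(φ⁻¹)_y u, d(φ⁻¹)_y v)`. -/
def metricInChart (I : ModelWithCorners ℝ E H) {M : Type*} [TopologicalSpace M] [ChartedSpace H M]
    (g : ∀ x : M, TangentSpace I x →L[ℝ] TangentSpace I x →L[ℝ] ℝ) (x₀ : M) (y : E) :
    E →L[ℝ] E →L[ℝ] ℝ :=
  let b : E →L[ℝ] E →L[ℝ] ℝ := g ((extChartAt I x₀).symm y)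
  let A : E →L[ℝ] E := mfderiv 𝓘(ℝ, E) I (extChartAt I x₀).symm y
  b.bilinearComp A A

/-- The tangent space at `x` is identified with `E` by the preferred chart at `x`, so that the
local expression of `g` in that chart agrees with `g` at `x` itself. -/
theorem metricInChart_self {I : ModelWithCorners ℝ E H} [I.Boundaryless]
    {M : Type*} [TopologicalSpace M] [ChartedSpace H M] [IsManifold I ∞ M]
    (g : ∀ x : M, TangentSpace I x →L[ℝ] TangentSpace I x →L[ℝ] ℝ) (x : M) (v w : E) :
    metricInChart I g x (extChartAt I x x) v w = g x v w := by
  have : IsManifold I 1 M := IsManifold.of_le (n := ∞) (by simp)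
  have key : (mfderiv 𝓘(ℝ, E) I (extChartAt I x).symm (extChartAt I x x) : E →L[ℝ] E)
      = ContinuousLinearMap.id ℝ E := by
    have h := TangentBundle.symmL_trivializationAt (I := I) (x₀ := x) (x := x)
      (mem_chart_source H x)
    rw [I.range_eq_univ, mfderivWithin_univ] at h
    rw [← h]
    ext v
    simpa using TangentBundle.symmL_trivializationAt_eq_core (I := I) (b₀ := x) (b := x)
      (mem_chart_source H x) ▸ (tangentBundleCore I M).coordChange_self (achart H x) x
        (mem_chart_source H x) v
  change g ((extChartAt I x).symm (extChartAt I x x))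
    ((mfderiv 𝓘(ℝ, E) I (extChartAt I x).symm (extChartAt I x x) : E →L[ℝ] E) v)
    ((mfderiv 𝓘(ℝ, E) I (extChartAt I x).symm (extChartAt I x x) : E →L[ℝ] E) w) = _
  rw [key, extChartAt_to_inv]
  rfl

/-- A semi-Riemannian metric: a smooth field of nondegenerate symmetric bilinear forms on the
tangent spaces of a manifold without boundary. (Its index is locally constant, hence constant on
every connected component.) -/
@[ext]
structure SemiRiemannianMetric (I : ModelWithCorners ℝ E H) (M : Type*)
    [TopologicalSpace M] [ChartedSpace H M] where
  toFun : ∀ x : M, TangentSpace I x →L[ℝ] TangentSpace I x →L[ℝ] ℝ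
  symm : ∀ x (v w : TangentSpace I x), toFun x v w = toFun x w v
  nondegenerate : ∀ x (v : TangentSpace I x), (∀ w : TangentSpace I x, toFun x v w = 0) → v = 0
  smooth : ∀ x₀ : M, ContDiffOn ℝ ∞ (metricInChart I toFun x₀) (extChartAt I x₀).target

namespace SemiRiemannianMetric

variable {I : ModelWithCorners ℝ E H} {M : Type*} [TopologicalSpace M] [ChartedSpace H M]

/-- The metric is Riemannian if it is positive definite. -/
def IsRiemannian (g : SemiRiemannianMetric I M) : Prop :=
  ∀ x (v : TangentSpace I x), v ≠ 0 → 0 < g.toFun x v v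

/-- The scalar curvature of `(M, g)` at `x`, computed in the preferred chart at `x`. -/
def scalarCurvature [FiniteDimensional ℝ E] (g : SemiRiemannianMetric I M) (x : M) : ℝ :=
  localScalarCurvature (metricInChart I g.toFun x) (extChartAt I x x)

/-- The Hessian of `h` at `x`, computed in the preferred chart at `x`; this is the chart that
identifies the tangent space at `x` with `E`. -/
def hessian (g : SemiRiemannianMetric I M) (h : M → ℝ) (x : M) (v w : TangentSpace I x) : ℝ :=
  localHessian (metricInChart I g.toFun x) (h ∘ (extChartAt I x).symm) (extChartAt I x x) v w

/-- `(M, g)` is a gradient Yamabe soliton with potential function `h` and soliton constant `ρ`: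
`h` is smooth and `(S_g - ρ) g = Hess_g h`. -/
def IsGradientYamabeSoliton [FiniteDimensional ℝ E] (g : SemiRiemannianMetric I M) (h : M → ℝ)
    (ρ : ℝ) : Prop :=
  ContMDiff I 𝓘(ℝ, ℝ) ∞ h ∧
    ∀ x (v w : TangentSpace I x), (g.scalarCurvature x - ρ) * g.toFun x v w = g.hessian h x v w

end SemiRiemannianMetric

section Products

variable {E' : Type*} [NormedAddCommGroup E'] [NormedSpace ℝ E']
  {H' : Type*} [TopologicalSpace H']
  {I : ModelWithCorners ℝ E H} {B : Type*} [TopologicalSpace B] [ChartedSpace H B]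
  {J : ModelWithCorners ℝ E' H'} {F : Type*} [TopologicalSpace F] [ChartedSpace H' F]

/-- The field of bilinear forms `π^* g_B + (f ∘ π)² σ^* g_F` on `B × F`, where `π` and `σ` are the
projections. -/
def warpedForm (gB : SemiRiemannianMetric I B) (gF : SemiRiemannianMetric J F) (f : B → ℝ)
    (p : B × F) :
    TangentSpace (I.prod J) p →L[ℝ] TangentSpace (I.prod J) p →L[ℝ] ℝ :=
  let b : E →L[ℝ] E →L[ℝ] ℝ := gB.toFun p.1
  let b' : E' →L[ℝ] E' →L[ℝ] ℝ := gF.toFun p.2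
  let r : E × E' →L[ℝ] E × E' →L[ℝ] ℝ :=
    b.bilinearComp (ContinuousLinearMap.fst ℝ E E') (ContinuousLinearMap.fst ℝ E E')
      + f p.1 ^ 2 •
        b'.bilinearComp (ContinuousLinearMap.snd ℝ E E') (ContinuousLinearMap.snd ℝ E E')
  r

theorem warpedForm_apply (gB : SemiRiemannianMetric I B) (gF : SemiRiemannianMetric J F)
    (f : B → ℝ) (p : B × F) (v w : TangentSpace (I.prod J) p) :
    warpedForm gB gF f p v w
      = gB.toFun p.1 v.1 w.1 + f p.1 ^ 2 * gF.toFun p.2 v.2 w.2 := rfl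

theorem mfderiv_extChartAt_symm_prod [I.Boundaryless] [J.Boundaryless]
    [IsManifold I ∞ B] [IsManifold J ∞ F] (p : B × F) {y : E × E'}
    (hy : y ∈ (extChartAt (I.prod J) p).target) (v : E × E') :
    (mfderiv 𝓘(ℝ, E × E') (I.prod J) (extChartAt (I.prod J) p).symm y v : E × E')
      = ((mfderiv 𝓘(ℝ, E) I (extChartAt I p.1).symm y.1 v.1 : E),
         (mfderiv 𝓘(ℝ, E') J (extChartAt J p.2).symm y.2 v.2 : E')) := by
  have hy' : y.1 ∈ (extChartAt I p.1).target ∧ y.2 ∈ (extChartAt J p.2).target := by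
    rw [extChartAt_prod] at hy; exact hy
  have h1 : MDifferentiableAt 𝓘(ℝ, E) I (extChartAt I p.1).symm y.1 := by
    have := mdifferentiableWithinAt_extChartAt_symm (I := I) hy'.1
    rwa [I.range_eq_univ, mdifferentiableWithinAt_univ] at this
  have h2 : MDifferentiableAt 𝓘(ℝ, E') J (extChartAt J p.2).symm y.2 := by
    have := mdifferentiableWithinAt_extChartAt_symm (I := J) hy'.2
    rwa [J.range_eq_univ, mdifferentiableWithinAt_univ] at this
  have h3 := mfderiv_prodMap (p := y) h1 h2
  rw [modelWithCornersSelf_prod, ← chartedSpaceSelf_prod, extChartAt_prod]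
  exact congrArg (fun L : E × E' →L[ℝ] E × E' => L v) h3

theorem warpedForm_smooth [FiniteDimensional ℝ E] [FiniteDimensional ℝ E'] [I.Boundaryless] [J.Boundaryless] [IsManifold I ∞ B] [IsManifold J ∞ F]
    (gB : SemiRiemannianMetric I B) (gF : SemiRiemannianMetric J F) (f : B → ℝ)
    (hf : ContMDiff I 𝓘(ℝ, ℝ) ∞ f) (p : B × F) :
    ContDiffOn ℝ ∞ (metricInChart (I.prod J) (warpedForm gB gF f) p)
      (extChartAt (I.prod J) p).target := by
  have hsub : ∀ y ∈ (extChartAt (I.prod J) p).target,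
      y.1 ∈ (extChartAt I p.1).target ∧ y.2 ∈ (extChartAt J p.2).target := by
    intro y hy; rw [extChartAt_prod] at hy; exact hy
  have hf' : ContDiffOn ℝ ∞ (f ∘ (extChartAt I p.1).symm) (extChartAt I p.1).target :=
    (hf.comp_contMDiffOn (contMDiffOn_extChartAt_symm p.1)).contDiffOn
  rw [contDiffOn_clm_apply]
  intro v
  rw [contDiffOn_clm_apply]
  intro w
  have h1 : ContDiffOn ℝ ∞ (fun y : E × E' => metricInChart I gB.toFun p.1 y.1 v.1 w.1)
      (extChartAt (I.prod J) p).target :=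
    (((gB.smooth p.1).comp contDiffOn_fst fun y hy => (hsub y hy).1).clm_apply
      contDiffOn_const).clm_apply contDiffOn_const
  have h2 : ContDiffOn ℝ ∞ (fun y : E × E' => metricInChart J gF.toFun p.2 y.2 v.2 w.2)
      (extChartAt (I.prod J) p).target :=
    (((gF.smooth p.2).comp contDiffOn_snd fun y hy => (hsub y hy).2).clm_apply
      contDiffOn_const).clm_apply contDiffOn_const
  have h3 : ContDiffOn ℝ ∞ (fun y : E × E' => f ((extChartAt I p.1).symm y.1))
      (extChartAt (I.prod J) p).target :=
    hf'.comp contDiffOn_fst fun y hy => (hsub y hy).1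
  refine (h1.add ((h3.pow 2).mul h2)).congr fun y hy => ?_
  have hs : (extChartAt (I.prod J) p).symm y
      = ((extChartAt I p.1).symm y.1, (extChartAt J p.2).symm y.2) := by
    rw [extChartAt_prod]; rfl
  have hv := mfderiv_extChartAt_symm_prod (I := I) (J := J) p hy v
  have hw := mfderiv_extChartAt_symm_prod (I := I) (J := J) p hy w
  change warpedForm gB gF f ((extChartAt (I.prod J) p).symm y)
    (mfderiv 𝓘(ℝ, E × E') (I.prod J) (extChartAt (I.prod J) p).symm y v : E × E')
    (mfderiv 𝓘(ℝ, E × E') (I.prod J) (extChartAt (I.prod J) p).symm y w : E × E') = _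
  rw [hv, hw, hs]
  rfl

namespace SemiRiemannianMetric

/-- The warped product metric `π^* g_B + (f ∘ π)² σ^* g_F` on `B × F`, with a smooth positive
warping function `f` on the base `B`. -/
def warpedProduct [FiniteDimensional ℝ E] [FiniteDimensional ℝ E'] [I.Boundaryless]
    [J.Boundaryless] [IsManifold I ∞ B] [IsManifold J ∞ F]
    (gB : SemiRiemannianMetric I B) (gF : SemiRiemannianMetric J F) (f : B → ℝ)
    (hf : ContMDiff I 𝓘(ℝ, ℝ) ∞ f) (hpos : ∀ x, 0 < f x) :
    SemiRiemannianMetric (I.prod J) (B × F) where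
  toFun := warpedForm gB gF f
  symm p v w :=
    congrArg₂ (fun a b : ℝ => a + f p.1 ^ 2 * b) (gB.symm p.1 v.1 w.1) (gF.symm p.2 v.2 w.2)
  nondegenerate p v hv := by
    refine Prod.ext (gB.nondegenerate p.1 v.1 fun w => ?_) (gF.nondegenerate p.2 v.2 fun w => ?_)
    · have h : gB.toFun p.1 v.1 w + f p.1 ^ 2 * gF.toFun p.2 v.2 0 = 0 :=
        hv ((w, (0 : E')) : E × E')
      simpa using h
    · have h : gB.toFun p.1 v.1 0 + f p.1 ^ 2 * gF.toFun p.2 v.2 w = 0 :=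
        hv (((0 : E), w) : E × E')
      simpa [(hpos p.1).ne'] using h
  smooth := warpedForm_smooth gB gF f hf

/-- The (direct) semi-Riemannian product metric `π^* g_B + σ^* g_F` on `B × F`, i.e. the warped
product with warping function `1`. -/
def prod [FiniteDimensional ℝ E] [FiniteDimensional ℝ E'] [I.Boundaryless]
    [J.Boundaryless] [IsManifold I ∞ B] [IsManifold J ∞ F]
    (gB : SemiRiemannianMetric I B) (gF : SemiRiemannianMetric J F) :
    SemiRiemannianMetric (I.prod J) (B × F) :=
  gB.warpedProduct gF (fun _ => 1) contMDiff_const fun _ => one_pos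

theorem prod_apply [FiniteDimensional ℝ E] [FiniteDimensional ℝ E'] [I.Boundaryless]
    [J.Boundaryless] [IsManifold I ∞ B] [IsManifold J ∞ F]
    (gB : SemiRiemannianMetric I B) (gF : SemiRiemannianMetric J F) (p : B × F)
    (v w : TangentSpace (I.prod J) p) :
    (gB.prod gF).toFun p v w = gB.toFun p.1 v.1 w.1 + gF.toFun p.2 v.2 w.2 := by
  refine (warpedForm_apply gB gF (fun _ => 1) p v w).trans ?_
  simp

/-- The metric `c² g`, for a constant `c > 0`. -/
def scale (g : SemiRiemannianMetric J F) (c : ℝ) (hc : 0 < c) : SemiRiemannianMetric J F where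
  toFun y := c ^ 2 • g.toFun y
  symm y v w := by simp [g.symm y v w]
  nondegenerate y v hv := g.nondegenerate y v fun w => by simpa [hc.ne'] using hv w
  smooth y₀ := (g.smooth y₀).const_smul (c ^ 2)

end SemiRiemannianMetric

end Products

end Manifolds
end

open scoped Manifold ContDiff

set_option linter.unusedSectionVars false

/-! ### Linear algebra of traces with respect to a nondegenerate form. -/

section MetricTrace

variable {E : Type*} [NormedAddCommGroup E] [NormedSpace ℝ E] [FiniteDimensional ℝ E]
  {E' : Type*} [NormedAddCommGroup E'] [NormedSpace ℝ E'] [FiniteDimensional ℝ E']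

/-! Evaluate the soliton equation on two vertical vectors. There the Hessian of a function `h` on
the base is `f ⟨∇h, ∇f⟩ g_F`, so the scalar curvature `S` of the warped product satisfies `f (S - ρ)
= ⟨∇h, ∇f⟩`. Inserting `S = S_B + λ_F / f² - 2d Δf / f - d (d - 1) |∇f|² / f²` and dividing by `2d`
gives `Δf + (d - 1) / (2f) |∇f|² + 1 / (2d) ⟨∇h, ∇f⟩ = f / (2d) (S_B + λ_F / f² - ρ) ≥ 0`. The
gradient terms have the form `Df(X)` with the continuous field `X = (d - 1) / (2f) ∇f + 1 / (2d)
∇h`, and there is no term of order zero. By Hopf's strong maximum principle the set where `f` takes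
its maximum is open; it is also closed and nonempty, hence all of the connected base.

Two lemmas carry the weight. `IsLocalWarpedProduct.localScalarCurvature_eq` is the curvature
formula, obtained from explicit Christoffel symbols. `eventually_eq_of_metricLaplacian_nonneg` is
the maximum principle, obtained from an exponential barrier. They meet in `warping_inequality` and
`eq_of_laplacian_inequality`.

Curvature and Hessian at a point are defined in the preferred chart of that point, whereas the
maximum principle needs the inequality on an open set of one chart. The curvature formula is used
only at the centre of a product chart, so just the Laplacian and `⟨∇u, ∇v⟩` have to be shown
independent of the chart. -/

theorem isInvertible_of_nondegenerate {b : E →L[ℝ] E →L[ℝ] ℝ}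
    (h : ∀ v, (∀ w, b v w = 0) → v = 0) : b.IsInvertible := by
  have hinj : Function.Injective (b : E →ₗ[ℝ] E →L[ℝ] ℝ) := by
    rw [injective_iff_map_eq_zero]
    intro v hv
    exact h v fun w => by simpa using congrArg (fun ξ : E →L[ℝ] ℝ => ξ w) hv
  have hdim : Module.finrank ℝ E = Module.finrank ℝ (E →L[ℝ] ℝ) := by
    rw [← (LinearMap.toContinuousLinearMap (𝕜 := ℝ) (E := E) (F' := ℝ)).finrank_eq]
    exact Subspace.dual_finrank_eq.symm
  exact ⟨(LinearEquiv.ofInjectiveOfFinrankEq _ hinj hdim).toContinuousLinearEquiv, by ext; rfl⟩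

theorem isInvertible_of_injective {A : E →L[ℝ] E} (h : ∀ v, A v = 0 → v = 0) :
    A.IsInvertible := by
  have hinj : Function.Injective (A : E →ₗ[ℝ] E) := (injective_iff_map_eq_zero _).2 h
  exact ⟨(LinearEquiv.ofInjectiveEndo _ hinj).toContinuousLinearEquiv, by ext; rfl⟩

/-- Split `T` into its restrictions to the two factors, each preceded by a projection; cyclicity of
the trace moves the projection to the other end. -/
theorem trace_prod (T : E × E' →ₗ[ℝ] E × E') :
    LinearMap.trace ℝ (E × E') T
      = LinearMap.trace ℝ E (LinearMap.fst ℝ E E' ∘ₗ T ∘ₗ LinearMap.inl ℝ E E')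
        + LinearMap.trace ℝ E' (LinearMap.snd ℝ E E' ∘ₗ T ∘ₗ LinearMap.inr ℝ E E') := by
  have hT : T = (T ∘ₗ LinearMap.inl ℝ E E') ∘ₗ LinearMap.fst ℝ E E'
      + (T ∘ₗ LinearMap.inr ℝ E E') ∘ₗ LinearMap.snd ℝ E E' := by
    refine LinearMap.ext fun v => ?_
    change T v = T (v.1, 0) + T (0, v.2)
    rw [← map_add]
    simp
  conv_lhs => rw [hT]
  rw [map_add, LinearMap.trace_comp_comm' (T ∘ₗ LinearMap.inl ℝ E E'),
    LinearMap.trace_comp_comm' (T ∘ₗ LinearMap.inr ℝ E E')]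

/-- The trace `tr (b⁻¹ q)` of a bilinear form `q` with respect to a nondegenerate form `b`. -/
noncomputable def metricTrace (b q : E →L[ℝ] E →L[ℝ] ℝ) : ℝ :=
  LinearMap.trace ℝ E (b.inverse ∘L q : E →L[ℝ] E)

theorem metricTrace_add (b q r : E →L[ℝ] E →L[ℝ] ℝ) :
    metricTrace b (q + r) = metricTrace b q + metricTrace b r := by
  simp only [metricTrace, ContinuousLinearMap.comp_add, ContinuousLinearMap.toLinearMap_add, map_add]

theorem metricTrace_smul (b q : E →L[ℝ] E →L[ℝ] ℝ) (c : ℝ) :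
    metricTrace b (c • q) = c * metricTrace b q := by
  simp only [metricTrace, ContinuousLinearMap.comp_smul, ContinuousLinearMap.toLinearMap_smul,
    map_smul, smul_eq_mul]

theorem metricTrace_sub (b q r : E →L[ℝ] E →L[ℝ] ℝ) :
    metricTrace b (q - r) = metricTrace b q - metricTrace b r := by
  have := metricTrace_add b q ((-1 : ℝ) • r)
  rw [metricTrace_smul, neg_one_smul, ← sub_eq_add_neg] at this
  linarith

theorem metricTrace_self {b : E →L[ℝ] E →L[ℝ] ℝ} (hb : b.IsInvertible) :
    metricTrace b b = Module.finrank ℝ E := by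
  rw [metricTrace, ContinuousLinearMap.IsInvertible.inverse_comp_self hb]
  exact LinearMap.trace_id ℝ E

theorem inverse_smul_form {b : E →L[ℝ] E →L[ℝ] ℝ} (hb : b.IsInvertible) {c : ℝ} (hc : c ≠ 0) :
    (c • b).IsInvertible ∧ (c • b).inverse = c⁻¹ • b.inverse := by
  have hi : (c • b).IsInvertible := isInvertible_of_nondegenerate fun v hv => by
    apply hb.injective
    ext w
    simpa [hc] using hv w
  refine ⟨hi, ?_⟩
  ext ξ
  rw [hi.inverse_apply_eq]
  simp [hb.self_apply_inverse, smul_smul, hc]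

theorem metricTrace_smul_left {b : E →L[ℝ] E →L[ℝ] ℝ} (hb : b.IsInvertible) {c : ℝ} (hc : c ≠ 0)
    (q : E →L[ℝ] E →L[ℝ] ℝ) : metricTrace (c • b) q = c⁻¹ * metricTrace b q := by
  simp only [metricTrace, (inverse_smul_form hb hc).2, ContinuousLinearMap.smul_comp,
    ContinuousLinearMap.toLinearMap_smul, map_smul, smul_eq_mul]

theorem continuous_trace :
    Continuous fun T : E →L[ℝ] E => LinearMap.trace ℝ E (T : E →ₗ[ℝ] E) :=
  (LinearMap.trace ℝ E ∘ₗ ContinuousLinearMap.coeLM ℝ).continuous_of_finiteDimensional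

/-- The endomorphisms `b⁻¹ q` before and after pulling back by `A` are conjugate under `A`. -/
theorem metricTrace_bilinearComp {b q : E →L[ℝ] E →L[ℝ] ℝ} (hb : b.IsInvertible)
    {A : E →L[ℝ] E} (hA : A.IsInvertible) :
    metricTrace (b.bilinearComp A A) (q.bilinearComp A A) = metricTrace b q := by
  have hi : (b.bilinearComp A A).IsInvertible := isInvertible_of_nondegenerate fun v hv => by
    apply hA.injective
    apply hb.injective
    ext w
    obtain ⟨w, rfl⟩ := hA.surjective w
    simpa using hv w
  have key : ((b.bilinearComp A A).inverse ∘L q.bilinearComp A A : E →L[ℝ] E)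
      = A.inverse ∘L ((b.inverse ∘L q) ∘L A) := by
    ext v
    simp only [ContinuousLinearMap.comp_apply]
    rw [hi.inverse_apply_eq]
    ext w
    simp [hA.self_apply_inverse, hb.self_apply_inverse]
  rw [metricTrace, key, metricTrace, ContinuousLinearMap.toLinearMap_comp, LinearMap.trace_comp_comm',
    ← ContinuousLinearMap.toLinearMap_comp, ContinuousLinearMap.comp_assoc, hA.self_comp_inverse]
  rfl

/-- Diagonalise the symmetric form `b`; nondegeneracy excludes null vectors from an orthogonal
basis. The formula serves to read off the sign of a trace when `b` is positive. -/
theorem exists_basis_metricTrace {b : E →L[ℝ] E →L[ℝ] ℝ} (hb : b.IsInvertible)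
    (hs : ∀ v w, b v w = b w v) :
    ∃ e : Module.Basis (Fin (Module.finrank ℝ E)) ℝ E, (∀ i, b (e i) (e i) ≠ 0) ∧
      ∀ q : E →L[ℝ] E →L[ℝ] ℝ, metricTrace b q = ∑ i, q (e i) (e i) / b (e i) (e i) := by
  let β : LinearMap.BilinForm ℝ E := LinearMap.mk₂ ℝ (fun v w => b v w) (by simp) (by simp)
    (by simp) (by simp)
  have hβ : LinearMap.IsSymm β := ⟨fun v w => hs v w⟩
  obtain ⟨e, he⟩ := LinearMap.BilinForm.exists_orthogonal_basis (B := β) hβ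
  have ho : ∀ i j, i ≠ j → b (e i) (e j) = 0 := fun i j hij => he hij
  have hexp : ∀ i v, b (e i) v = e.repr v i * b (e i) (e i) := by
    intro i v
    conv_lhs => rw [← e.sum_repr v]
    rw [map_sum, Finset.sum_eq_single i]
    · simp
    · intro j _ hj
      simp [ho i j hj.symm]
    · simp
  have hne : ∀ i, b (e i) (e i) ≠ 0 := by
    intro i hi
    refine e.ne_zero i (hb.injective ?_)
    ext v
    rw [hexp, hi]
    simp
  refine ⟨e, hne, fun q => ?_⟩
  rw [metricTrace, LinearMap.trace_eq_matrix_trace ℝ e, Matrix.trace]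
  refine Finset.sum_congr rfl fun i _ => ?_
  rw [Matrix.diag_apply, LinearMap.toMatrix_apply, eq_div_iff (hne i)]
  have h := hexp i (b.inverse (q (e i)))
  rw [hs, hb.self_apply_inverse] at h
  exact h.symm

theorem metricTrace_nonpos {b q : E →L[ℝ] E →L[ℝ] ℝ} (hpos : ∀ v, v ≠ 0 → 0 < b v v)
    (hs : ∀ v w, b v w = b w v) (hq : ∀ v, q v v ≤ 0) : metricTrace b q ≤ 0 := by
  have hb : b.IsInvertible := isInvertible_of_nondegenerate fun v hv => by
    by_contra hne
    exact (hpos v hne).ne' (hv v)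
  obtain ⟨e, -, he⟩ := exists_basis_metricTrace hb hs
  rw [he]
  exact Finset.sum_nonpos fun i _ => div_nonpos_of_nonpos_of_nonneg (hq _) (hpos _ (e.ne_zero i)).le

/-- The rank-one form `ξ ⊗ η`. -/
noncomputable def tensorForm (ξ η : E →L[ℝ] ℝ) : E →L[ℝ] E →L[ℝ] ℝ := ξ.smulRight η

theorem metricTrace_tensorForm (b : E →L[ℝ] E →L[ℝ] ℝ) (ξ η : E →L[ℝ] ℝ) :
    metricTrace b (tensorForm ξ η) = ξ (b.inverse η) := by
  have : (b.inverse ∘L tensorForm ξ η : E →L[ℝ] E) = ξ.smulRight (b.inverse η) := by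
    ext v
    simp [tensorForm]
  rw [metricTrace, this]
  exact LinearMap.trace_smulRight (ξ : E →ₗ[ℝ] ℝ) (b.inverse η)

/-- The orthogonal direct sum of two bilinear forms. -/
noncomputable def prodForm (b : E →L[ℝ] E →L[ℝ] ℝ) (b' : E' →L[ℝ] E' →L[ℝ] ℝ) :
    E × E' →L[ℝ] E × E' →L[ℝ] ℝ :=
  b.bilinearComp (ContinuousLinearMap.fst ℝ E E') (ContinuousLinearMap.fst ℝ E E')
    + b'.bilinearComp (ContinuousLinearMap.snd ℝ E E') (ContinuousLinearMap.snd ℝ E E')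

@[simp]
theorem prodForm_apply (b : E →L[ℝ] E →L[ℝ] ℝ) (b' : E' →L[ℝ] E' →L[ℝ] ℝ) (v w : E × E') :
    prodForm b b' v w = b v.1 w.1 + b' v.2 w.2 := rfl

theorem isInvertible_prodForm {b : E →L[ℝ] E →L[ℝ] ℝ} {b' : E' →L[ℝ] E' →L[ℝ] ℝ}
    (hb : b.IsInvertible) (hb' : b'.IsInvertible) : (prodForm b b').IsInvertible :=
  isInvertible_of_nondegenerate fun v hv => by
    refine Prod.ext (hb.injective ?_) (hb'.injective ?_)
    · ext w
      simpa using hv (w, 0)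
    · ext w
      simpa using hv (0, w)

/-- Inverting an orthogonal sum means inverting each summand on the restricted covector, so only the
diagonal blocks of `q` enter the trace. -/
theorem metricTrace_prodForm {b : E →L[ℝ] E →L[ℝ] ℝ} {b' : E' →L[ℝ] E' →L[ℝ] ℝ}
    (hb : b.IsInvertible) (hb' : b'.IsInvertible) (q : E × E' →L[ℝ] E × E' →L[ℝ] ℝ) :
    metricTrace (prodForm b b') q
      = metricTrace b (q.bilinearComp (ContinuousLinearMap.inl ℝ E E')
          (ContinuousLinearMap.inl ℝ E E'))
        + metricTrace b' (q.bilinearComp (ContinuousLinearMap.inr ℝ E E')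
          (ContinuousLinearMap.inr ℝ E E')) := by
  have hinv : ∀ ξ : E × E' →L[ℝ] ℝ, (prodForm b b').inverse ξ
      = (b.inverse (ξ ∘L ContinuousLinearMap.inl ℝ E E'),
        b'.inverse (ξ ∘L ContinuousLinearMap.inr ℝ E E')) := by
    intro ξ
    rw [(isInvertible_prodForm hb hb').inverse_apply_eq]
    refine ContinuousLinearMap.ext fun w => ?_
    rw [prodForm_apply, hb.self_apply_inverse, hb'.self_apply_inverse]
    change ξ w = ξ (w.1, 0) + ξ (0, w.2)
    rw [← map_add]
    simp
  rw [metricTrace, trace_prod]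
  congr 1
  · rw [metricTrace]
    congr 1
    ext v
    simp only [LinearMap.comp_apply, ContinuousLinearMap.coe_coe, ContinuousLinearMap.comp_apply, hinv]
    rfl
  · rw [metricTrace]
    congr 1
    ext v
    simp only [LinearMap.comp_apply, ContinuousLinearMap.coe_coe, ContinuousLinearMap.comp_apply, hinv]
    rfl

end MetricTrace

open Filter Topology

/-! ### Christoffel symbols, Hessian, Laplacian and gradient product. -/

section Christoffel

variable {E : Type*} [NormedAddCommGroup E] [NormedSpace ℝ E] [FiniteDimensional ℝ E]
  {W : Type*} [NormedAddCommGroup W] [NormedSpace ℝ W]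

theorem fderiv_apply_apply {A : W → E →L[ℝ] E →L[ℝ] ℝ} {y : W} (hA : DifferentiableAt ℝ A y)
    (u : W) (v w : E) : fderiv ℝ A y u v w = fderiv ℝ (fun z => A z v w) y u := by
  have h := (hA.hasFDerivAt.clm_apply (hasFDerivAt_const v y)).clm_apply (hasFDerivAt_const w y)
  rw [h.fderiv]
  simp

theorem christoffel_koszul {G : E → E →L[ℝ] E →L[ℝ] ℝ} {y : E} (hG : (G y).IsInvertible)
    (u v z : E) : G y (christoffel G y u v) z
      = 1 / 2 * (fderiv ℝ G y u v z + fderiv ℝ G y v u z - fderiv ℝ G y z u v) := by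
  rw [christoffel_apply, map_smul, hG.self_apply_inverse]
  simp

/-- Nondegeneracy makes the Koszul formula characterise the symbols. Later symbols are therefore
found by writing down a candidate and checking its pairings. -/
theorem christoffel_eq_of_koszul {G : E → E →L[ℝ] E →L[ℝ] ℝ} {y : E} (hG : (G y).IsInvertible)
    {u v x : E} (h : ∀ z, G y x z
      = 1 / 2 * (fderiv ℝ G y u v z + fderiv ℝ G y v u z - fderiv ℝ G y z u v)) :
    christoffel G y u v = x := by
  apply hG.injective
  ext z
  rw [christoffel_koszul hG, h]

theorem fderiv_metric_symm {G : E → E →L[ℝ] E →L[ℝ] ℝ} {y : E} (hd : DifferentiableAt ℝ G y)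
    (hs : ∀ᶠ z in 𝓝 y, ∀ v w, G z v w = G z w v) (u v w : E) :
    fderiv ℝ G y u v w = fderiv ℝ G y u w v := by
  rw [fderiv_apply_apply hd, fderiv_apply_apply hd]
  congr 1
  apply Filter.EventuallyEq.fderiv_eq
  filter_upwards [hs] with z hz using hz v w

/-- Metric compatibility `∇G = 0`: adding two Koszul formulas cancels all but one derivative of `G`.
-/
theorem christoffel_metric {G : E → E →L[ℝ] E →L[ℝ] ℝ} {y : E} (hG : (G y).IsInvertible)
    (hd : DifferentiableAt ℝ G y) (hs : ∀ᶠ z in 𝓝 y, ∀ v w, G z v w = G z w v) (u v w : E) :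
    G y (christoffel G y u v) w + G y v (christoffel G y u w) = fderiv ℝ G y u v w := by
  rw [hs.self_of_nhds v, christoffel_koszul hG, christoffel_koszul hG,
    fderiv_metric_symm hd hs u w v, fderiv_metric_symm hd hs w u v, fderiv_metric_symm hd hs v u w]
  ring

theorem christoffel_symm {G : E → E →L[ℝ] E →L[ℝ] ℝ} {y : E} (hG : (G y).IsInvertible)
    (hd : DifferentiableAt ℝ G y) (hs : ∀ᶠ z in 𝓝 y, ∀ v w, G z v w = G z w v) (u v : E) :
    christoffel G y u v = christoffel G y v u := by
  refine christoffel_eq_of_koszul hG fun z => ?_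
  rw [christoffel_koszul hG, fderiv_metric_symm hd hs z u v]
  ring

theorem contDiffAt_inverse_metric {G : W → E →L[ℝ] E →L[ℝ] ℝ} {y : W}
    (hG : (G y).IsInvertible) {n : ℕ∞ω} (hd : ContDiffAt ℝ n G y) :
    ContDiffAt ℝ n (fun z => (G z).inverse) y := by
  have : CompleteSpace E := FiniteDimensional.complete ℝ E
  exact (ContinuousLinearMap.IsInvertible.contDiffAt_map_inverse hG).comp y hd

theorem contDiffAt_christoffel {G : E → E →L[ℝ] E →L[ℝ] ℝ} {y : E} (hG : (G y).IsInvertible)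
    (hd : ContDiffAt ℝ ∞ G y) : ContDiffAt ℝ ∞ (christoffel G) y := by
  have hD : ContDiffAt ℝ ∞ (fderiv ℝ G) y := hd.fderiv_right (by simp)
  have hDf : ContDiffAt ℝ ∞ (fun z => (fderiv ℝ G z).flip) y :=
    (ContinuousLinearMap.flipₗᵢ ℝ E E (E →L[ℝ] ℝ)).toContinuousLinearEquiv.contDiff.contDiffAt.comp
      y hD
  have hinv := contDiffAt_inverse_metric hG hd
  have h1 : ContDiffAt ℝ ∞ (fun z => (ContinuousLinearMap.compL ℝ E (E →L[ℝ] ℝ) E (G z).inverse)) y :=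
    contDiffAt_const.clm_apply hinv
  exact (h1.clm_comp ((hD.add hDf).sub (contDiffAt_const.clm_comp hDf))).const_smul (1 / 2 : ℝ)

/-- The Hessian as a continuous bilinear form. -/
noncomputable def hessianForm (G : E → E →L[ℝ] E →L[ℝ] ℝ) (u : E → ℝ) (y : E) : E →L[ℝ] E →L[ℝ] ℝ :=
  fderiv ℝ (fderiv ℝ u) y - ContinuousLinearMap.compL ℝ E E ℝ (fderiv ℝ u y) ∘L christoffel G y

theorem hessianForm_apply (G : E → E →L[ℝ] E →L[ℝ] ℝ) (u : E → ℝ) (y v w : E) :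
    hessianForm G u y v w = localHessian G u y v w := rfl

/-- The Laplacian `tr_G (∇ du)`. -/
noncomputable def metricLaplacian (G : E → E →L[ℝ] E →L[ℝ] ℝ) (u : E → ℝ) (y : E) : ℝ :=
  metricTrace (G y) (hessianForm G u y)

/-- The product `⟨∇u, ∇v⟩` of two gradients. -/
noncomputable def gradProd (G : E → E →L[ℝ] E →L[ℝ] ℝ) (u v : E → ℝ) (y : E) : ℝ :=
  fderiv ℝ u y ((G y).inverse (fderiv ℝ v y))

/-! ### Behaviour under a change of coordinates. -/

section ChangeOfCoordinates

variable {G G' : E → E →L[ℝ] E →L[ℝ] ℝ} {φ : E → E} {y : E}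

theorem fderiv_pullback_metric (hφ : ContDiffAt ℝ ∞ φ y) (hd : DifferentiableAt ℝ G (φ y))
    (hd' : DifferentiableAt ℝ G' y)
    (hG' : ∀ᶠ z in 𝓝 y, G' z = (G (φ z)).bilinearComp (fderiv ℝ φ z) (fderiv ℝ φ z))
    (u v w : E) :
    fderiv ℝ G' y u v w
      = fderiv ℝ G (φ y) (fderiv ℝ φ y u) (fderiv ℝ φ y v) (fderiv ℝ φ y w)
        + G (φ y) (fderiv ℝ (fderiv ℝ φ) y u v) (fderiv ℝ φ y w)
        + G (φ y) (fderiv ℝ φ y v) (fderiv ℝ (fderiv ℝ φ) y u w) := by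
  have h1 : HasFDerivAt φ (fderiv ℝ φ y) y := (hφ.differentiableAt (by simp)).hasFDerivAt
  have h2 : HasFDerivAt (fderiv ℝ φ) (fderiv ℝ (fderiv ℝ φ) y) y :=
    ((hφ.fderiv_right (m := ∞) (by simp)).differentiableAt (by simp)).hasFDerivAt
  have h3 : HasFDerivAt (fun z => G (φ z)) ((fderiv ℝ G (φ y)) ∘L fderiv ℝ φ y) y :=
    hd.hasFDerivAt.comp y h1
  have h4 := (h3.clm_apply (h2.clm_apply (hasFDerivAt_const v y))).clm_apply
    (h2.clm_apply (hasFDerivAt_const w y))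
  have h5 : (fun z => G' z v w)
      =ᶠ[𝓝 y] fun z => G (φ z) (fderiv ℝ φ z v) (fderiv ℝ φ z w) := by
    filter_upwards [hG'] with z hz
    rw [hz]
    rfl
  rw [fderiv_apply_apply hd', h5.fderiv_eq, h4.fderiv]
  simp
  ring

/-- The inhomogeneous transformation law. Differentiating the pulled-back metric produces terms in
`D²φ`; by symmetry of `D²φ` and `G` they cancel in the Koszul formula except for one. -/
theorem christoffel_pullback (hφ : ContDiffAt ℝ ∞ φ y) (hd : DifferentiableAt ℝ G (φ y))
    (hi : (G (φ y)).IsInvertible) (hs : ∀ᶠ z in 𝓝 (φ y), ∀ v w, G z v w = G z w v)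
    (hd' : DifferentiableAt ℝ G' y) (hi' : (G' y).IsInvertible)
    (hφi : (fderiv ℝ φ y).IsInvertible)
    (hG' : ∀ᶠ z in 𝓝 y, G' z = (G (φ z)).bilinearComp (fderiv ℝ φ z) (fderiv ℝ φ z))
    (u v : E) :
    fderiv ℝ φ y (christoffel G' y u v)
      = christoffel G (φ y) (fderiv ℝ φ y u) (fderiv ℝ φ y v) + fderiv ℝ (fderiv ℝ φ) y u v := by
  -- Isolate the symbol of `G'`, so that its Koszul characterisation applies to the candidate.
  rw [eq_comm, ← hφi.inverse_apply_eq, eq_comm]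
  refine christoffel_eq_of_koszul hi' fun z => ?_
  have hsymm : ∀ a b, fderiv ℝ (fderiv ℝ φ) y a b = fderiv ℝ (fderiv ℝ φ) y b a :=
    hφ.isSymmSndFDerivAt (by rw [minSmoothness_of_isRCLikeNormedField]; exact WithTop.coe_le_coe.2 le_top)
  have h1 := hG'.self_of_nhds
  rw [fderiv_pullback_metric hφ hd hd' hG', fderiv_pullback_metric hφ hd hd' hG',
    fderiv_pullback_metric hφ hd hd' hG', h1]
  simp only [ContinuousLinearMap.bilinearComp_apply, hφi.self_apply_inverse, map_add,
    add_apply]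
  rw [christoffel_koszul hi, hsymm v u, hsymm z u, hsymm z v,
    hs.self_of_nhds (fderiv ℝ φ y v) (fderiv ℝ (fderiv ℝ φ) y u z)]
  ring

/-- The chain rule for `D²(u ∘ φ)` yields the extra term `Du(D²φ(v, w))`, which the inhomogeneous
part of the Christoffel symbol cancels. -/
theorem localHessian_pullback (hφ : ContDiffAt ℝ ∞ φ y) (hd : DifferentiableAt ℝ G (φ y))
    (hi : (G (φ y)).IsInvertible) (hs : ∀ᶠ z in 𝓝 (φ y), ∀ v w, G z v w = G z w v)
    (hd' : DifferentiableAt ℝ G' y) (hi' : (G' y).IsInvertible)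
    (hφi : (fderiv ℝ φ y).IsInvertible)
    (hG' : ∀ᶠ z in 𝓝 y, G' z = (G (φ z)).bilinearComp (fderiv ℝ φ z) (fderiv ℝ φ z))
    {u u' : E → ℝ} (hu : ContDiffAt ℝ ∞ u (φ y)) (hu' : u' =ᶠ[𝓝 y] u ∘ φ) (v w : E) :
    localHessian G' u' y v w
      = localHessian G u (φ y) (fderiv ℝ φ y v) (fderiv ℝ φ y w) := by
  have h1 : HasFDerivAt φ (fderiv ℝ φ y) y := (hφ.differentiableAt (by simp)).hasFDerivAt
  have h2 : HasFDerivAt (fderiv ℝ φ) (fderiv ℝ (fderiv ℝ φ) y) y :=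
    ((hφ.fderiv_right (m := ∞) (by simp)).differentiableAt (by simp)).hasFDerivAt
  have h3 : fderiv ℝ u' =ᶠ[𝓝 y] fun z => fderiv ℝ u (φ z) ∘L fderiv ℝ φ z := by
    have e1 : ∀ᶠ z in 𝓝 y, ContDiffAt ℝ 1 φ z :=
      (hφ.of_le (m := 1) (by simp)).eventually (by simp)
    have e2 : ∀ᶠ z in 𝓝 y, ContDiffAt ℝ 1 u (φ z) :=
      hφ.continuousAt.eventually ((hu.of_le (m := 1) (by simp)).eventually (by simp))
    filter_upwards [hu'.fderiv (𝕜 := ℝ), e1, e2] with z hz hz1 hz2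
    rw [hz]
    exact fderiv_comp z (hz2.differentiableAt (by simp)) (hz1.differentiableAt one_ne_zero)
  have h4 : HasFDerivAt (fun z => fderiv ℝ u (φ z))
      (fderiv ℝ (fderiv ℝ u) (φ y) ∘L fderiv ℝ φ y) y :=
    ((hu.fderiv_right (m := ∞) (by simp)).differentiableAt (by simp)).hasFDerivAt.comp y h1
  rw [localHessian, h3.fderiv_eq, (h4.clm_comp h2).fderiv, h3.self_of_nhds, localHessian]
  simp only [add_apply, ContinuousLinearMap.comp_apply,
    ContinuousLinearMap.compL_apply, ContinuousLinearMap.flip_apply]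
  rw [christoffel_pullback hφ hd hi hs hd' hi' hφi hG', map_add]
  ring

theorem metricLaplacian_pullback (hφ : ContDiffAt ℝ ∞ φ y) (hd : DifferentiableAt ℝ G (φ y))
    (hi : (G (φ y)).IsInvertible) (hs : ∀ᶠ z in 𝓝 (φ y), ∀ v w, G z v w = G z w v)
    (hd' : DifferentiableAt ℝ G' y) (hi' : (G' y).IsInvertible)
    (hφi : (fderiv ℝ φ y).IsInvertible)
    (hG' : ∀ᶠ z in 𝓝 y, G' z = (G (φ z)).bilinearComp (fderiv ℝ φ z) (fderiv ℝ φ z))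
    {u u' : E → ℝ} (hu : ContDiffAt ℝ ∞ u (φ y)) (hu' : u' =ᶠ[𝓝 y] u ∘ φ) :
    metricLaplacian G' u' y = metricLaplacian G u (φ y) := by
  have h : hessianForm G' u' y
      = (hessianForm G u (φ y)).bilinearComp (fderiv ℝ φ y) (fderiv ℝ φ y) := by
    ext v w
    exact localHessian_pullback hφ hd hi hs hd' hi' hφi hG' hu hu' v w
  rw [metricLaplacian, metricLaplacian, h, hG'.self_of_nhds, metricTrace_bilinearComp hi hφi]

theorem gradProd_pullback (hφ : DifferentiableAt ℝ φ y)
    (hi : (G (φ y)).IsInvertible) (hi' : (G' y).IsInvertible)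
    (hφi : (fderiv ℝ φ y).IsInvertible)
    (hG' : G' y = (G (φ y)).bilinearComp (fderiv ℝ φ y) (fderiv ℝ φ y))
    {u u' v v' : E → ℝ} (hu : DifferentiableAt ℝ u (φ y)) (hu' : u' =ᶠ[𝓝 y] u ∘ φ)
    (hv : DifferentiableAt ℝ v (φ y)) (hv' : v' =ᶠ[𝓝 y] v ∘ φ) :
    gradProd G' u' v' y = gradProd G u v (φ y) := by
  have h1 : fderiv ℝ u' y = fderiv ℝ u (φ y) ∘L fderiv ℝ φ y := by
    rw [hu'.fderiv_eq]
    exact fderiv_comp y hu hφ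
  have h2 : fderiv ℝ v' y = fderiv ℝ v (φ y) ∘L fderiv ℝ φ y := by
    rw [hv'.fderiv_eq]
    exact fderiv_comp y hv hφ
  have h3 : (G' y).inverse (fderiv ℝ v' y)
      = (fderiv ℝ φ y).inverse ((G (φ y)).inverse (fderiv ℝ v (φ y))) := by
    rw [hi'.inverse_apply_eq, hG']
    ext w
    simp [hφi.self_apply_inverse, hi.self_apply_inverse, h2]
  rw [gradProd, gradProd, h3, h1, ContinuousLinearMap.comp_apply, hφi.self_apply_inverse]

end ChangeOfCoordinates

end Christoffel

/-! ### Christoffel symbols of a warped product and their derivatives. -/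

section LocalWarpedProduct

variable {E : Type*} [NormedAddCommGroup E] [NormedSpace ℝ E] [FiniteDimensional ℝ E]
  {E' : Type*} [NormedAddCommGroup E'] [NormedSpace ℝ E'] [FiniteDimensional ℝ E']

/-- `g` is a smooth field of nondegenerate symmetric bilinear forms near `y`. -/
structure IsLocalMetric (g : E → E →L[ℝ] E →L[ℝ] ℝ) (y : E) : Prop where
  smooth : ∀ᶠ z in 𝓝 y, ContDiffAt ℝ ∞ g z
  invertible : ∀ᶠ z in 𝓝 y, (g z).IsInvertible
  symm : ∀ᶠ z in 𝓝 y, ∀ v w, g z v w = g z w v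

namespace IsLocalMetric

variable {g : E → E →L[ℝ] E →L[ℝ] ℝ} {y : E}

theorem eventually (hg : IsLocalMetric g y) : ∀ᶠ z in 𝓝 y, IsLocalMetric g z := by
  filter_upwards [hg.smooth.eventually_nhds, hg.invertible.eventually_nhds,
    hg.symm.eventually_nhds] with z h1 h2 h3 using ⟨h1, h2, h3⟩

theorem contDiffAt (hg : IsLocalMetric g y) : ContDiffAt ℝ ∞ g y := hg.smooth.self_of_nhds

theorem differentiableAt (hg : IsLocalMetric g y) : DifferentiableAt ℝ g y :=
  hg.contDiffAt.differentiableAt (by simp)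

theorem isInvertible (hg : IsLocalMetric g y) : (g y).IsInvertible := hg.invertible.self_of_nhds

theorem differentiableAt_christoffel (hg : IsLocalMetric g y) :
    DifferentiableAt ℝ (christoffel g) y :=
  (contDiffAt_christoffel hg.isInvertible hg.contDiffAt).differentiableAt (by simp)

theorem christoffel_comm (hg : IsLocalMetric g y) (u v : E) :
    christoffel g y u v = christoffel g y v u :=
  christoffel_symm hg.isInvertible hg.differentiableAt hg.symm u v

end IsLocalMetric

/-- The gradient of `u` with respect to `g`. -/
noncomputable def metricGradient (g : E → E →L[ℝ] E →L[ℝ] ℝ) (u : E → ℝ) (y : E) : E :=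
  (g y).inverse (fderiv ℝ u y)

theorem differentiableAt_metricGradient {g : E → E →L[ℝ] E →L[ℝ] ℝ} {y : E}
    (hg : IsLocalMetric g y) {u : E → ℝ} (hu : ContDiffAt ℝ ∞ u y) :
    DifferentiableAt ℝ (metricGradient g u) y :=
  ((contDiffAt_inverse_metric hg.isInvertible hg.contDiffAt).clm_apply
    (hu.fderiv_right (m := ∞) (by simp))).differentiableAt (by simp)

/-- The covariant derivative of the gradient represents the Hessian. -/
theorem inverse_hessianForm {g : E → E →L[ℝ] E →L[ℝ] ℝ} {y : E}
    (hg : IsLocalMetric g y) {u : E → ℝ} (hu : ContDiffAt ℝ ∞ u y) (v : E) :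
    (g y).inverse (hessianForm g u y v)
      = fderiv ℝ (metricGradient g u) y v + christoffel g y v (metricGradient g u y) := by
  rw [hg.isInvertible.inverse_apply_eq]
  ext w
  have hN := (differentiableAt_metricGradient hg hu).hasFDerivAt
  -- Differentiate `g(∇u, w) = Du(w)` along `v`; metric compatibility then trades the derivative of
  -- `g` for Christoffel terms.
  have h1 := (hg.differentiableAt.hasFDerivAt.clm_apply hN).clm_apply (hasFDerivAt_const w y)
  have h2 : (fun z => g z (metricGradient g u z) w) =ᶠ[𝓝 y] fun z => fderiv ℝ u z w := by
    filter_upwards [hg.invertible] with z hz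
    rw [metricGradient, hz.self_apply_inverse]
  have h3 : HasFDerivAt (fderiv ℝ u) (fderiv ℝ (fderiv ℝ u) y) y :=
    ((hu.fderiv_right (m := ∞) (by simp)).differentiableAt (by simp)).hasFDerivAt
  have h4 := h3.clm_apply (hasFDerivAt_const w y)
  have h5 := congrArg (fun L : E →L[ℝ] ℝ => L v) (h1.unique (h4.congr_of_eventuallyEq h2))
  simp at h5
  have h6 := christoffel_metric hg.isInvertible hg.differentiableAt hg.symm v
    (metricGradient g u y) w
  have h7 : g y (metricGradient g u y) (christoffel g y v w)
      = fderiv ℝ u y (christoffel g y v w) := by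
    rw [metricGradient, hg.isInvertible.self_apply_inverse]
  rw [hessianForm_apply, localHessian, map_add, add_apply]
  linarith

/-- Near `p`, the field `G` is the warped product of `g` and `k` with warping function `F`. -/
structure IsLocalWarpedProduct (G : E × E' → E × E' →L[ℝ] E × E' →L[ℝ] ℝ)
    (g : E → E →L[ℝ] E →L[ℝ] ℝ) (k : E' → E' →L[ℝ] E' →L[ℝ] ℝ) (F : E → ℝ) (p : E × E') :
    Prop where
  base : IsLocalMetric g p.1
  fiber : IsLocalMetric k p.2
  smooth : ∀ᶠ z in 𝓝 p.1, ContDiffAt ℝ ∞ F z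
  ne_zero : ∀ᶠ z in 𝓝 p.1, F z ≠ 0
  eq : ∀ᶠ q in 𝓝 p, G q = prodForm (g q.1) (F q.1 ^ 2 • k q.2)

namespace IsLocalWarpedProduct

variable {G : E × E' → E × E' →L[ℝ] E × E' →L[ℝ] ℝ} {g : E → E →L[ℝ] E →L[ℝ] ℝ}
  {k : E' → E' →L[ℝ] E' →L[ℝ] ℝ} {F : E → ℝ} {p : E × E'}

theorem eventually (h : IsLocalWarpedProduct G g k F p) :
    ∀ᶠ q in 𝓝 p, IsLocalWarpedProduct G g k F q := by
  filter_upwards [continuousAt_fst.eventually h.base.eventually,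
    continuousAt_snd.eventually h.fiber.eventually,
    continuousAt_fst.eventually h.smooth.eventually_nhds,
    continuousAt_fst.eventually h.ne_zero.eventually_nhds, h.eq.eventually_nhds]
    with q h1 h2 h3 h4 h5 using ⟨h1, h2, h3, h4, h5⟩

theorem contDiffAt (h : IsLocalWarpedProduct G g k F p) : ContDiffAt ℝ ∞ G p := by
  have h1 : ContDiffAt ℝ ∞ (fun q : E × E' => g q.1) p := h.base.contDiffAt.comp p contDiffAt_fst
  have h2 : ContDiffAt ℝ ∞ (fun q : E × E' => k q.2) p := h.fiber.contDiffAt.comp p contDiffAt_snd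
  have h3 : ContDiffAt ℝ ∞ (fun q : E × E' => F q.1) p :=
    h.smooth.self_of_nhds.comp p contDiffAt_fst
  refine ContDiffAt.congr_of_eventuallyEq ?_ h.eq
  -- Pulling a form back along a projection is composition with fixed linear maps on both sides,
  -- which makes smoothness in the base point visible.
  exact ((contDiffAt_const (c := (ContinuousLinearMap.compL ℝ (E × E') E ℝ).flip
      (ContinuousLinearMap.fst ℝ E E'))).clm_comp
        (h1.clm_comp (contDiffAt_const (c := ContinuousLinearMap.fst ℝ E E')))).add
    ((contDiffAt_const (c := (ContinuousLinearMap.compL ℝ (E × E') E' ℝ).flip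
      (ContinuousLinearMap.snd ℝ E E'))).clm_comp
        (((h3.pow 2).smul h2).clm_comp (contDiffAt_const (c := ContinuousLinearMap.snd ℝ E E'))))

theorem isLocalMetric (h : IsLocalWarpedProduct G g k F p) : IsLocalMetric G p where
  smooth := h.eventually.mono fun _ hq => hq.contDiffAt
  invertible := h.eventually.mono fun q hq => by
    rw [hq.eq.self_of_nhds]
    exact isInvertible_prodForm hq.base.isInvertible (inverse_smul_form hq.fiber.isInvertible
      (pow_ne_zero 2 hq.ne_zero.self_of_nhds)).1
  symm := h.eventually.mono fun q hq v w => by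
    rw [hq.eq.self_of_nhds]
    simp [hq.base.symm.self_of_nhds v.1 w.1, hq.fiber.symm.self_of_nhds v.2 w.2]

theorem fderiv_apply (h : IsLocalWarpedProduct G g k F p) (u v w : E × E') :
    fderiv ℝ G p u v w = fderiv ℝ g p.1 u.1 v.1 w.1
      + F p.1 ^ 2 * fderiv ℝ k p.2 u.2 v.2 w.2
      + 2 * F p.1 * fderiv ℝ F p.1 u.1 * k p.2 v.2 w.2 := by
  have h0 : (fun q => G q v w)
      =ᶠ[𝓝 p] fun q => g q.1 v.1 w.1 + F q.1 ^ 2 * k q.2 v.2 w.2 := by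
    filter_upwards [h.eq] with q hq
    rw [hq]
    rfl
  have h1 : HasFDerivAt (fun q : E × E' => g q.1) _ p :=
    h.base.differentiableAt.hasFDerivAt.comp p hasFDerivAt_fst
  have h2 : HasFDerivAt (fun q : E × E' => k q.2) _ p :=
    h.fiber.differentiableAt.hasFDerivAt.comp p hasFDerivAt_snd
  have h3 : HasFDerivAt (fun q : E × E' => F q.1) _ p :=
    (h.smooth.self_of_nhds.differentiableAt (by simp)).hasFDerivAt.comp p hasFDerivAt_fst
  have h4 := ((h1.clm_apply (hasFDerivAt_const v.1 p)).clm_apply (hasFDerivAt_const w.1 p)).add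
    ((h3.pow 2).mul ((h2.clm_apply (hasFDerivAt_const v.2 p)).clm_apply
      (hasFDerivAt_const w.2 p)))
  rw [fderiv_apply_apply (h.contDiffAt.differentiableAt (by simp)), h0.fderiv_eq]
  refine (congrArg (fun L : E × E' →L[ℝ] ℝ => L u) h4.fderiv).trans ?_
  simp
  ring

/-- The warped product connection in one formula: for horizontal `X` and vertical `V`, `W` it
encodes `∇_X V = (XF / F) V` and the normal part `-F k(V, W) ∇F` of `∇_V W`. The candidate is
checked against the Koszul formula. -/
theorem christoffel_apply (h : IsLocalWarpedProduct G g k F p) (u v : E × E') :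
    christoffel G p u v
      = (christoffel g p.1 u.1 v.1 - (F p.1 * k p.2 u.2 v.2) • metricGradient g F p.1,
        christoffel k p.2 u.2 v.2 + (fderiv ℝ F p.1 u.1 / F p.1) • v.2
          + (fderiv ℝ F p.1 v.1 / F p.1) • u.2) := by
  have hF := h.ne_zero.self_of_nhds
  refine christoffel_eq_of_koszul h.isLocalMetric.isInvertible fun z => ?_
  rw [h.fderiv_apply, h.fderiv_apply, h.fderiv_apply, h.eq.self_of_nhds, prodForm_apply]
  have h1 := christoffel_koszul h.base.isInvertible u.1 v.1 z.1
  have h2 := christoffel_koszul h.fiber.isInvertible u.2 v.2 z.2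
  have h3 : g p.1 (metricGradient g F p.1) z.1 = fderiv ℝ F p.1 z.1 := by
    rw [metricGradient, h.base.isInvertible.self_apply_inverse]
  simp only [map_sub, map_add, map_smul, sub_apply, add_apply, smul_apply, smul_eq_mul, h1, h2, h3]
  rw [h.fiber.symm.self_of_nhds u.2 z.2]
  rw [h.fiber.symm.self_of_nhds v.2 z.2]
  rw [h.fiber.symm.self_of_nhds u.2 v.2]
  field_simp
  ring

theorem hasFDerivAt_christoffel (h : IsLocalWarpedProduct G g k F p) (v w : E × E') :
    HasFDerivAt (fun q => christoffel G q v w)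
      ((fderiv ℝ (christoffel G) p).flip v |>.flip w) p := by
  have := (h.isLocalMetric.differentiableAt_christoffel.hasFDerivAt.clm_apply
    (hasFDerivAt_const v p)).clm_apply (hasFDerivAt_const w p)
  refine this.congr_fderiv ?_
  ext u <;> simp

/-- The explicit symbols hold on a neighbourhood, so they may be differentiated with both arguments
frozen. The mixed and vertical cases below follow the same pattern. -/
theorem fderiv_christoffel_horizontal (h : IsLocalWarpedProduct G g k F p) (u : E × E') (v w : E) :
    fderiv ℝ (christoffel G) p u (v, 0) (w, 0) = (fderiv ℝ (christoffel g) p.1 u.1 v w, 0) := by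
  have h0 : (fun q => christoffel G q (v, 0) (w, 0))
      =ᶠ[𝓝 p] fun q => (christoffel g q.1 v w, (0 : E')) := by
    filter_upwards [h.eventually] with q hq
    rw [hq.christoffel_apply]
    simp
  have h1 : HasFDerivAt (fun q : E × E' => christoffel g q.1) _ p :=
    h.base.differentiableAt_christoffel.hasFDerivAt.comp p hasFDerivAt_fst
  have h2 := ((h1.clm_apply (hasFDerivAt_const v p)).clm_apply (hasFDerivAt_const w p)).prodMk
    (hasFDerivAt_const (0 : E') p)
  have h3 := (h.hasFDerivAt_christoffel (v, 0) (w, 0)).unique (h2.congr_of_eventuallyEq h0)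
  have h4 := congrArg (fun L : E × E' →L[ℝ] E × E' => L u) h3
  simpa using h4

theorem fderiv_christoffel_mixed (h : IsLocalWarpedProduct G g k F p) (u : E × E') (a : E')
    (w : E) :
    fderiv ℝ (christoffel G) p u (0, a) (w, 0) = (0,
      (fderiv ℝ (fderiv ℝ F) p.1 u.1 w / F p.1
        - fderiv ℝ F p.1 u.1 * fderiv ℝ F p.1 w / F p.1 ^ 2) • a) := by
  have h0 : (fun q => christoffel G q (0, a) (w, 0))
      =ᶠ[𝓝 p] fun q => ((0 : E), (fderiv ℝ F q.1 w * (F q.1)⁻¹) • a) := by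
    filter_upwards [h.eventually] with q hq
    rw [hq.christoffel_apply]
    simp [div_eq_mul_inv]
  have hF := h.smooth.self_of_nhds
  have h1 : HasFDerivAt (fun q : E × E' => fderiv ℝ F q.1) _ p :=
    ((hF.fderiv_right (m := ∞) (by simp)).differentiableAt (by simp)).hasFDerivAt.comp p
      hasFDerivAt_fst
  have h2 : HasFDerivAt (fun q : E × E' => F q.1) _ p :=
    (hF.differentiableAt (by simp)).hasFDerivAt.comp p hasFDerivAt_fst
  have h2' : HasFDerivAt (fun q : E × E' => (F q.1)⁻¹) _ p :=
    (hasDerivAt_inv h.ne_zero.self_of_nhds).comp_hasFDerivAt p h2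
  have h3 := (hasFDerivAt_const (0 : E) p).prodMk
    (((h1.clm_apply (hasFDerivAt_const w p)).mul h2').smul_const a)
  have h4 := (h.hasFDerivAt_christoffel (0, a) (w, 0)).unique (h3.congr_of_eventuallyEq h0)
  have h5 := congrArg (fun L : E × E' →L[ℝ] E × E' => L u) h4
  simp at h5
  rw [h5]
  congr 2
  field_simp
  ring

theorem fderiv_christoffel_mixed' (h : IsLocalWarpedProduct G g k F p) (u : E × E') (a : E')
    (w : E) :
    fderiv ℝ (christoffel G) p u (w, 0) (0, a) = fderiv ℝ (christoffel G) p u (0, a) (w, 0) := by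
  have h0 : (fun q => christoffel G q (w, 0) (0, a))
      =ᶠ[𝓝 p] fun q => christoffel G q (0, a) (w, 0) := by
    filter_upwards [h.eventually] with q hq using hq.isLocalMetric.christoffel_comm _ _
  have h4 := (h.hasFDerivAt_christoffel (w, 0) (0, a)).unique
    ((h.hasFDerivAt_christoffel (0, a) (w, 0)).congr_of_eventuallyEq h0)
  exact congrArg (fun L : E × E' →L[ℝ] E × E' => L u) h4

theorem fderiv_christoffel_vertical (h : IsLocalWarpedProduct G g k F p) (u : E × E') (b c : E') :
    fderiv ℝ (christoffel G) p u (0, b) (0, c)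
      = (-((F p.1 * k p.2 b c) • fderiv ℝ (metricGradient g F) p.1 u.1
          + (F p.1 * fderiv ℝ k p.2 u.2 b c + fderiv ℝ F p.1 u.1 * k p.2 b c)
            • metricGradient g F p.1),
        fderiv ℝ (christoffel k) p.2 u.2 b c) := by
  have h0 : (fun q => christoffel G q (0, b) (0, c))
      =ᶠ[𝓝 p] fun q => (-((F q.1 * k q.2 b c) • metricGradient g F q.1),
        christoffel k q.2 b c) := by
    filter_upwards [h.eventually] with q hq
    rw [hq.christoffel_apply]
    simp
  have hF := h.smooth.self_of_nhds
  have h1 : HasFDerivAt (fun q : E × E' => F q.1) _ p :=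
    (hF.differentiableAt (by simp)).hasFDerivAt.comp p hasFDerivAt_fst
  have h2 : HasFDerivAt (fun q : E × E' => k q.2) _ p :=
    h.fiber.differentiableAt.hasFDerivAt.comp p hasFDerivAt_snd
  have h3 : HasFDerivAt (fun q : E × E' => metricGradient g F q.1) _ p :=
    (differentiableAt_metricGradient h.base hF).hasFDerivAt.comp p hasFDerivAt_fst
  have h4 : HasFDerivAt (fun q : E × E' => christoffel k q.2) _ p :=
    h.fiber.differentiableAt_christoffel.hasFDerivAt.comp p hasFDerivAt_snd
  have h5 := (((h1.mul ((h2.clm_apply (hasFDerivAt_const b p)).clm_apply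
    (hasFDerivAt_const c p))).smul h3).neg).prodMk
    ((h4.clm_apply (hasFDerivAt_const b p)).clm_apply (hasFDerivAt_const c p))
  have h6 := (h.hasFDerivAt_christoffel (0, b) (0, c)).unique (h5.congr_of_eventuallyEq h0)
  have h7 := congrArg (fun L : E × E' →L[ℝ] E × E' => L u) h6
  simp at h7
  rw [h7]
  congr 2
  module

end IsLocalWarpedProduct

end LocalWarpedProduct

/-! ### Curvature of a warped product. -/

section WarpedCurvature

variable {E : Type*} [NormedAddCommGroup E] [NormedSpace ℝ E] [FiniteDimensional ℝ E]
  {E' : Type*} [NormedAddCommGroup E'] [NormedSpace ℝ E'] [FiniteDimensional ℝ E']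

/-- The Ricci tensor as a continuous bilinear form. -/
noncomputable def ricciForm (G : E → E →L[ℝ] E →L[ℝ] ℝ) (y : E) : E →L[ℝ] E →L[ℝ] ℝ :=
  LinearMap.toContinuousLinearMap
    (LinearMap.toContinuousLinearMap.toLinearMap ∘ₗ ricciTensor G y)

theorem ricciForm_apply (G : E → E →L[ℝ] E →L[ℝ] ℝ) (y v w : E) :
    ricciForm G y v w = LinearMap.trace ℝ E (curvatureMap G y v w) := rfl

theorem localScalarCurvature_eq_metricTrace (G : E → E →L[ℝ] E →L[ℝ] ℝ) (y : E) :
    localScalarCurvature G y = metricTrace (G y) (ricciForm G y) := rfl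

theorem curvatureMap_apply (G : E → E →L[ℝ] E →L[ℝ] ℝ) (y u v w : E) :
    curvatureMap G y v w u
      = fderiv ℝ (christoffel G) y u v w - fderiv ℝ (christoffel G) y v u w
        + christoffel G y u (christoffel G y v w) - christoffel G y v (christoffel G y u w) := rfl

namespace IsLocalWarpedProduct

variable {G : E × E' → E × E' →L[ℝ] E × E' →L[ℝ] ℝ} {g : E → E →L[ℝ] E →L[ℝ] ℝ}
  {k : E' → E' →L[ℝ] E' →L[ℝ] ℝ} {F : E → ℝ} {p : E × E'}

/-- Only those blocks of the curvature are computed that enter the traces giving the Ricci tensor on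
two horizontal or two vertical vectors. -/
theorem curvature_horizontal (h : IsLocalWarpedProduct G g k F p) (u v w : E) :
    (curvatureMap G p (v, 0) (w, 0) (u, 0)).1 = curvatureMap g p.1 v w u := by
  simp only [curvatureMap_apply, h.fderiv_christoffel_horizontal, h.christoffel_apply]
  simp

theorem curvature_mixed_horizontal (h : IsLocalWarpedProduct G g k F p) (a : E') (v w : E) :
    (curvatureMap G p (v, 0) (w, 0) (0, a)).2 = (-(localHessian g F p.1 v w / F p.1)) • a := by
  have hF := h.ne_zero.self_of_nhds
  simp only [curvatureMap_apply, h.fderiv_christoffel_horizontal, h.fderiv_christoffel_mixed,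
    h.christoffel_apply, localHessian]
  simp only [Prod.snd_add, Prod.snd_sub, map_zero, smul_zero, mul_zero,
    zero_smul, sub_zero, zero_add, add_zero, zero_apply, zero_div, smul_smul, zero_sub, ← sub_smul,
    ← neg_smul, ← add_smul]
  congr 1
  field_simp
  ring

theorem curvature_mixed_vertical (h : IsLocalWarpedProduct G g k F p) (u : E) (b c : E') :
    (curvatureMap G p (0, b) (0, c) (u, 0)).1
      = (-(F p.1 * k p.2 b c)) • (g p.1).inverse (hessianForm g F p.1 u) := by
  have hF := h.ne_zero.self_of_nhds
  -- The covariant derivative of `∇F` is what the connection terms assemble into.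
  rw [inverse_hessianForm h.base h.smooth.self_of_nhds]
  simp only [curvatureMap_apply, h.fderiv_christoffel_vertical, h.fderiv_christoffel_mixed',
    h.fderiv_christoffel_mixed, h.christoffel_apply]
  simp only [Prod.fst_add, Prod.fst_sub, map_zero, smul_zero, mul_zero, map_neg, map_smul,
    zero_smul, sub_zero, zero_add, add_zero, zero_apply, zero_div, zero_sub, smul_add, smul_eq_mul]
  have e : F p.1 * (fderiv ℝ F p.1 u / F p.1 * k p.2 b c) = fderiv ℝ F p.1 u * k p.2 b c := by
    field_simp
  rw [e]
  module

/-- A Gauss equation: the normal part of the fibre connection corrects the intrinsic curvature by a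
term of constant-curvature type with factor `|∇F|²`. -/
theorem curvature_vertical (h : IsLocalWarpedProduct G g k F p) (a b c : E') :
    (curvatureMap G p (0, b) (0, c) (0, a)).2
      = curvatureMap k p.2 b c a - gradProd g F F p.1 • (k p.2 b c • a - k p.2 a c • b) := by
  have hF := h.ne_zero.self_of_nhds
  simp only [curvatureMap_apply, h.fderiv_christoffel_vertical, h.christoffel_apply]
  simp only [Prod.snd_add, Prod.snd_sub, map_zero, smul_zero, map_neg, map_smul,
    zero_smul, zero_add, add_zero, zero_apply, zero_div, zero_sub, smul_eq_mul]
  have e : fderiv ℝ F p.1 (metricGradient g F p.1) = gradProd g F F p.1 := rfl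
  rw [e]
  have e1 : ∀ s : ℝ, -(F p.1 * s * gradProd g F F p.1) / F p.1 = -(s * gradProd g F F p.1) := by
    intro s
    field_simp
  rw [e1, e1]
  module

/-- Horizontal directions contribute the Ricci tensor of the base; on the fibre the map is scalar,
so each vertical direction contributes `-Hess F / F`. -/
theorem ricciForm_horizontal (h : IsLocalWarpedProduct G g k F p) (v w : E) :
    ricciForm G p (v, 0) (w, 0) = ricciForm g p.1 v w
      - Module.finrank ℝ E' / F p.1 * hessianForm g F p.1 v w := by
  have h1 : LinearMap.fst ℝ E E' ∘ₗ curvatureMap G p (v, 0) (w, 0) ∘ₗ LinearMap.inl ℝ E E'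
      = curvatureMap g p.1 v w := LinearMap.ext fun u => h.curvature_horizontal u v w
  have h2 : LinearMap.snd ℝ E E' ∘ₗ curvatureMap G p (v, 0) (w, 0) ∘ₗ LinearMap.inr ℝ E E'
      = (-(localHessian g F p.1 v w / F p.1)) • LinearMap.id :=
    LinearMap.ext fun a => h.curvature_mixed_horizontal a v w
  rw [ricciForm_apply, trace_prod, h1, h2, map_smul, LinearMap.trace_id, ← ricciForm_apply,
    hessianForm_apply, smul_eq_mul]
  ring

/-- The horizontal trace produces the Laplacian of `F`. In the vertical one, the Gauss correction
has trace `(d - 1) k(b, c)`, where `d` is the fibre dimension. -/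
theorem ricciForm_vertical (h : IsLocalWarpedProduct G g k F p) (b c : E') :
    ricciForm G p (0, b) (0, c) = ricciForm k p.2 b c
      - (F p.1 * metricLaplacian g F p.1
        + (Module.finrank ℝ E' - 1) * gradProd g F F p.1) * k p.2 b c := by
  have h1 : LinearMap.fst ℝ E E' ∘ₗ curvatureMap G p (0, b) (0, c) ∘ₗ LinearMap.inl ℝ E E'
      = (-(F p.1 * k p.2 b c)) • ((g p.1).inverse ∘L hessianForm g F p.1 : E →L[ℝ] E).toLinearMap :=
    LinearMap.ext fun u => h.curvature_mixed_vertical u b c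
  have h2 : LinearMap.snd ℝ E E' ∘ₗ curvatureMap G p (0, b) (0, c) ∘ₗ LinearMap.inr ℝ E E'
      = curvatureMap k p.2 b c - gradProd g F F p.1 • (k p.2 b c • LinearMap.id
        - ((k p.2).flip c).toLinearMap.smulRight b) :=
    LinearMap.ext fun a => h.curvature_vertical a b c
  rw [ricciForm_apply, trace_prod, h1, h2, map_smul, map_sub, map_smul, map_sub, map_smul,
    LinearMap.trace_id, LinearMap.trace_smulRight, ← ricciForm_apply]
  change -(F p.1 * k p.2 b c) * metricLaplacian g F p.1 + _ = _
  simp only [smul_eq_mul, ContinuousLinearMap.coe_coe, ContinuousLinearMap.flip_apply]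
  ring

/-- The scalar curvature of a warped product. -/
theorem localScalarCurvature_eq (h : IsLocalWarpedProduct G g k F p) :
    localScalarCurvature G p = localScalarCurvature g p.1
      + localScalarCurvature k p.2 / F p.1 ^ 2
      - 2 * Module.finrank ℝ E' * metricLaplacian g F p.1 / F p.1
      - Module.finrank ℝ E' * (Module.finrank ℝ E' - 1) * gradProd g F F p.1 / F p.1 ^ 2 := by
  have hF := h.ne_zero.self_of_nhds
  have hF2 := pow_ne_zero 2 hF
  have hk := h.fiber.isInvertible
  have h1 : (ricciForm G p).bilinearComp (ContinuousLinearMap.inl ℝ E E')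
      (ContinuousLinearMap.inl ℝ E E')
      = ricciForm g p.1 - (Module.finrank ℝ E' / F p.1) • hessianForm g F p.1 := by
    ext v w
    exact h.ricciForm_horizontal v w
  have h2 : (ricciForm G p).bilinearComp (ContinuousLinearMap.inr ℝ E E')
      (ContinuousLinearMap.inr ℝ E E')
      = ricciForm k p.2 - (F p.1 * metricLaplacian g F p.1
        + (Module.finrank ℝ E' - 1) * gradProd g F F p.1) • k p.2 := by
    ext b c
    exact h.ricciForm_vertical b c
  simp only [localScalarCurvature_eq_metricTrace]
  rw [h.eq.self_of_nhds, metricTrace_prodForm h.base.isInvertible (inverse_smul_form hk hF2).1,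
    h1, h2, metricTrace_smul_left hk hF2, metricTrace_sub, metricTrace_sub, metricTrace_smul,
    metricTrace_smul, metricTrace_self hk]
  change _ - _ * metricLaplacian g F p.1 + _ = _
  field_simp
  ring

/-- The Hessian, along the fibre, of a function on the base. -/
theorem localHessian_vertical (h : IsLocalWarpedProduct G g k F p) {u : E → ℝ} {u' : E × E' → ℝ}
    (hu : ContDiffAt ℝ ∞ u p.1) (hu' : u' =ᶠ[𝓝 p] fun q => u q.1) (b c : E') :
    localHessian G u' p (0, b) (0, c) = F p.1 * k p.2 b c * gradProd g u F p.1 := by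
  have h1 : fderiv ℝ u' =ᶠ[𝓝 p] fun q => fderiv ℝ u q.1 ∘L ContinuousLinearMap.fst ℝ E E' := by
    filter_upwards [hu'.fderiv (𝕜 := ℝ), continuousAt_fst.eventually
      ((hu.of_le (m := 1) (by simp)).eventually (by simp))] with q hq hq1
    rw [hq]
    exact ((hq1.differentiableAt one_ne_zero).hasFDerivAt.comp q hasFDerivAt_fst).fderiv
  have h2 : HasFDerivAt (fun q : E × E' => fderiv ℝ u q.1) _ p :=
    ((hu.fderiv_right (m := ∞) (by simp)).differentiableAt (by simp)).hasFDerivAt.comp p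
      hasFDerivAt_fst
  rw [localHessian, h1.fderiv_eq,
    (h2.clm_comp (hasFDerivAt_const (ContinuousLinearMap.fst ℝ E E') p)).fderiv,
    h1.self_of_nhds, h.christoffel_apply]
  simp only [ContinuousLinearMap.comp_apply, ContinuousLinearMap.coe_fst', map_zero, zero_apply,
    zero_sub, map_neg, map_smul, gradProd, metricGradient, smul_eq_mul, add_apply]
  simp

end IsLocalWarpedProduct

end WarpedCurvature

/-! ### The strong maximum principle. -/

section MaximumPrinciple

theorem fderiv_fderiv_nonpos_of_isLocalMax {E : Type*} [NormedAddCommGroup E] [NormedSpace ℝ E]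
    {w : E → ℝ} {p : E} (hw : ContDiffAt ℝ ∞ w p) (hmax : IsLocalMax w p) (e : E) :
    fderiv ℝ (fderiv ℝ w) p e e ≤ 0 := by
  by_contra! hpos
  set l : ℝ → E := fun t => p + t • e
  have hl : ∀ t, HasDerivAt l e t := fun t => by
    simpa [l] using ((hasDerivAt_id t).smul_const e).const_add p
  have hl0 : l 0 = p := by simp [l]
  have hlc : Tendsto l (𝓝 0) (𝓝 p) := by
    have := (hl 0).continuousAt.tendsto
    rwa [hl0] at this
  have hd1 : deriv (w ∘ l) =ᶠ[𝓝 0] fun t => fderiv ℝ w (l t) e := by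
    filter_upwards [hlc.eventually ((hw.of_le (m := 1) (by simp)).eventually (by simp))] with t ht
    exact ((ht.differentiableAt one_ne_zero).hasFDerivAt.comp_hasDerivAt t (hl t)).deriv
  have hD : HasFDerivAt (fderiv ℝ w) (fderiv ℝ (fderiv ℝ w) p) (l 0) := by
    rw [hl0]
    exact ((hw.fderiv_right (m := ∞) (by simp)).differentiableAt (by simp)).hasFDerivAt
  have hd2 : deriv (deriv (w ∘ l)) 0 = fderiv ℝ (fderiv ℝ w) p e e := by
    rw [hd1.deriv_eq]
    have := (hD.comp_hasDerivAt (0 : ℝ) (hl 0)).clm_apply (hasDerivAt_const (0 : ℝ) e)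
    simpa using this.deriv
  have hd0 : deriv (w ∘ l) 0 = 0 := by
    refine hd1.self_of_nhds.trans ?_
    simp [hl0, hmax.fderiv_eq_zero]
  have hmax' : IsLocalMax (w ∘ l) 0 := by
    have := hlc.eventually hmax
    filter_upwards [this] with t ht
    simpa [hl0] using ht
  have hc : ContinuousAt (w ∘ l) 0 := by
    refine ContinuousAt.comp ?_ (hl 0).continuousAt
    rw [hl0]
    exact hw.continuousAt
  -- A positive second derivative would make the maximum a minimum too, so `w` would be locally
  -- constant along the line and the second derivative zero.
  have hmin : IsLocalMin (w ∘ l) 0 :=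
    isLocalMin_of_deriv_deriv_pos (by rw [hd2]; exact hpos) hd0 hc
  have hconst : (w ∘ l) =ᶠ[𝓝 0] fun _ => (w ∘ l) 0 := by
    filter_upwards [hmax', hmin] with t h1 h2 using le_antisymm h1 h2
  have h1 := hconst.deriv
  have h2 := h1.deriv_eq
  rw [hd2] at h2
  simp at h2
  linarith

/-! ### The exponential barrier. -/

section Barrier

variable {E : Type*} [NormedAddCommGroup E] [NormedSpace ℝ E] [FiniteDimensional ℝ E]
  {G : E → E →L[ℝ] E →L[ℝ] ℝ} {y : E}

theorem metricLaplacian_add_smul {u v : E → ℝ} (hu : ContDiffAt ℝ ∞ u y)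
    (hv : ContDiffAt ℝ ∞ v y) (c : ℝ) :
    metricLaplacian G (fun z => u z + c * v z) y
        = metricLaplacian G u y + c * metricLaplacian G v y ∧
      fderiv ℝ (fun z => u z + c * v z) y = fderiv ℝ u y + c • fderiv ℝ v y := by
  have hD : ∀ᶠ z in 𝓝 y, fderiv ℝ (fun z => u z + c * v z) z = fderiv ℝ u z + c • fderiv ℝ v z := by
    filter_upwards [(hu.of_le (m := 1) (by simp)).eventually (by simp),
      (hv.of_le (m := 1) (by simp)).eventually (by simp)] with z h1 h2
    exact ((h1.differentiableAt one_ne_zero).hasFDerivAt.add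
      ((h2.differentiableAt one_ne_zero).hasFDerivAt.const_mul c)).fderiv
  have h1 : HasFDerivAt (fderiv ℝ u) _ y :=
    ((hu.fderiv_right (m := ∞) (by simp)).differentiableAt (by simp)).hasFDerivAt
  have h2 : HasFDerivAt (fderiv ℝ v) _ y :=
    ((hv.fderiv_right (m := ∞) (by simp)).differentiableAt (by simp)).hasFDerivAt
  have hH : hessianForm G (fun z => u z + c * v z) y = hessianForm G u y + c • hessianForm G v y := by
    rw [hessianForm, EventuallyEq.fderiv_eq hD, hD.self_of_nhds]
    refine (congrArg (fun L => L - _) (h1.add (h2.const_smul c)).fderiv).trans ?_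
    ext a b
    simp [hessianForm]
    ring
  exact ⟨by rw [metricLaplacian, hH, metricTrace_add, metricTrace_smul]; rfl, hD.self_of_nhds⟩

theorem metricLaplacian_exp {q : E → ℝ} (hq : ContDiffAt ℝ ∞ q y) (c : ℝ) :
    metricLaplacian G (fun z => Real.exp (c * q z)) y
        = Real.exp (c * q y) * (c ^ 2 * gradProd G q q y + c * metricLaplacian G q y) ∧
      fderiv ℝ (fun z => Real.exp (c * q z)) y = (Real.exp (c * q y) * c) • fderiv ℝ q y := by
  have hE : ∀ᶠ z in 𝓝 y, HasFDerivAt (fun z => Real.exp (c * q z))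
      ((Real.exp (c * q z) * c) • fderiv ℝ q z) z := by
    filter_upwards [(hq.of_le (m := 1) (by simp)).eventually (by simp)] with z hz
    have := ((hz.differentiableAt one_ne_zero).hasFDerivAt.const_mul c).exp
    rwa [smul_smul] at this
  have hD : fderiv ℝ (fun z => Real.exp (c * q z))
      =ᶠ[𝓝 y] fun z => (Real.exp (c * q z) * c) • fderiv ℝ q z := hE.mono fun z hz => hz.fderiv
  have h1 : HasFDerivAt (fderiv ℝ q) _ y :=
    ((hq.fderiv_right (m := ∞) (by simp)).differentiableAt (by simp)).hasFDerivAt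
  have hH : hessianForm G (fun z => Real.exp (c * q z)) y
      = (Real.exp (c * q y) * c ^ 2) • tensorForm (fderiv ℝ q y) (fderiv ℝ q y)
        + (Real.exp (c * q y) * c) • hessianForm G q y := by
    rw [hessianForm, hD.fderiv_eq, hD.self_of_nhds]
    refine (congrArg (fun L => L - _) ((hE.self_of_nhds.mul_const c).smul h1).fderiv).trans ?_
    ext a b
    simp [hessianForm, tensorForm]
    ring
  refine ⟨?_, hD.self_of_nhds⟩
  rw [metricLaplacian, hH, metricTrace_add, metricTrace_smul, metricTrace_smul,
    metricTrace_tensorForm]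
  change _ * gradProd G q q y + _ * metricLaplacian G q y = _
  ring

theorem continuousAt_metricLaplacian (hG : IsLocalMetric G y) {u : E → ℝ}
    (hu : ContDiffAt ℝ ∞ u y) : ContinuousAt (metricLaplacian G u) y := by
  have h1 : ContinuousAt (fun z => (G z).inverse) y :=
    (contDiffAt_inverse_metric hG.isInvertible hG.contDiffAt).continuousAt
  have hD : ContDiffAt ℝ ∞ (fderiv ℝ u) y := hu.fderiv_right (by simp)
  have h2 : ContinuousAt (fderiv ℝ (fderiv ℝ u)) y :=
    (hD.fderiv_right (m := ∞) (by simp)).continuousAt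
  have h3 : ContinuousAt (hessianForm G u) y :=
    h2.sub (ContinuousAt.clm_comp
      ((ContinuousLinearMap.compL ℝ E E ℝ).continuous.continuousAt.comp hD.continuousAt)
      (contDiffAt_christoffel hG.isInvertible hG.contDiffAt).continuousAt)
  exact continuous_trace.continuousAt.comp (h1.clm_comp h3)

theorem continuousAt_gradProd (hG : IsLocalMetric G y) {u v : E → ℝ}
    (hu : ContDiffAt ℝ ∞ u y) (hv : ContDiffAt ℝ ∞ v y) : ContinuousAt (gradProd G u v) y :=
  ((hu.fderiv_right (m := ∞) (by simp)).continuousAt).clm_apply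
    (differentiableAt_metricGradient hG hv).continuousAt

theorem gradProd_self_pos (hG : (G y).IsInvertible) (hpos : ∀ v, v ≠ 0 → 0 < G y v v) {u : E → ℝ}
    (hu : fderiv ℝ u y ≠ 0) : 0 < gradProd G u u y := by
  have h1 : G y ((G y).inverse (fderiv ℝ u y)) = fderiv ℝ u y := hG.self_apply_inverse _
  have h2 : (G y).inverse (fderiv ℝ u y) ≠ 0 := by
    intro h
    rw [h, map_zero] at h1
    exact hu h1.symm
  have h3 := hpos _ h2
  rwa [h1] at h3

/-- With `L = Δ + X`, one has `L exp(-a q) = a exp(-a q) (a |∇q|² - L q)`. As `|∇q|²` is positive on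
the compact set, any `a` above the supremum of `L q / |∇q|²` works. -/
theorem exists_exp_barrier {K : Set E} (hK : IsCompact K) (hG : ∀ y ∈ K, IsLocalMetric G y)
    (hpos : ∀ y ∈ K, ∀ v, v ≠ 0 → 0 < G y v v) {X : E → E} (hX : ContinuousOn X K) {q : E → ℝ}
    (hq : ContDiff ℝ ∞ q) (hq0 : ∀ y ∈ K, fderiv ℝ q y ≠ 0) :
    ∃ a : ℝ, 0 < a ∧ ∀ y ∈ K, 0 < metricLaplacian G (fun z => Real.exp (-a * q z)) y
      + fderiv ℝ (fun z => Real.exp (-a * q z)) y (X y) := by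
  have hm : ∀ y ∈ K, 0 < gradProd G q q y := fun y hy =>
    gradProd_self_pos (hG y hy).isInvertible (hpos y hy) (hq0 y hy)
  have hc : ContinuousOn (fun y => (metricLaplacian G q y + fderiv ℝ q y (X y)) / gradProd G q q y)
      K := by
    refine ContinuousOn.div (ContinuousOn.add ?_ ?_) ?_ fun y hy => (hm y hy).ne'
    · exact fun y hy => (continuousAt_metricLaplacian (hG y hy) hq.contDiffAt).continuousWithinAt
    · exact ((hq.continuous_fderiv (by simp)).continuousOn).clm_apply hX
    · exact fun y hy => (continuousAt_gradProd (hG y hy) hq.contDiffAt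
        hq.contDiffAt).continuousWithinAt
  obtain ⟨C, hC⟩ := hK.bddAbove_image hc
  -- The bound `C` may be negative (or arbitrary when `K` is empty), and `a` must be positive.
  refine ⟨max C 0 + 1, by positivity, fun y hy => ?_⟩
  set a := max C 0 + 1
  have ha : 0 < a := by positivity
  have h1 : (metricLaplacian G q y + fderiv ℝ q y (X y)) / gradProd G q q y ≤ C :=
    hC (Set.mem_image_of_mem _ hy)
  have h2 : metricLaplacian G q y + fderiv ℝ q y (X y) < a * gradProd G q q y := by
    rw [div_le_iff₀ (hm y hy)] at h1
    refine h1.trans_lt (mul_lt_mul_of_pos_right ?_ (hm y hy))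
    exact (le_max_left C 0).trans_lt (lt_add_one _)
  obtain ⟨e1, e2⟩ := metricLaplacian_exp (G := G) (hq.contDiffAt (x := y)) (-a)
  rw [e1, e2]
  have : 0 < Real.exp (-a * q y) * (a * (a * gradProd G q q y
      - (metricLaplacian G q y + fderiv ℝ q y (X y)))) :=
    mul_pos (Real.exp_pos _) (mul_pos ha (sub_pos.2 h2))
  simp only [smul_apply, smul_eq_mul]
  linarith

end Barrier

/-- The strong maximum principle of Hopf, in local form. -/
theorem eventually_eq_of_metricLaplacian_nonneg {E : Type*} [NormedAddCommGroup E]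
    [InnerProductSpace ℝ E] [FiniteDimensional ℝ E] {G : E → E →L[ℝ] E →L[ℝ] ℝ} {U : Set E}
    (hU : IsOpen U) (hG : ∀ y ∈ U, IsLocalMetric G y)
    (hpos : ∀ y ∈ U, ∀ v, v ≠ 0 → 0 < G y v v) {u : E → ℝ} (hu : ∀ y ∈ U, ContDiffAt ℝ ∞ u y)
    {X : E → E} (hX : ContinuousOn X U)
    (hL : ∀ y ∈ U, 0 ≤ metricLaplacian G u y + fderiv ℝ u y (X y)) {M : ℝ}
    (hM : ∀ y ∈ U, u y ≤ M) {y₀ : E} (hy₀ : y₀ ∈ U) (h₀ : u y₀ = M) :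
    ∀ᶠ y in 𝓝 y₀, u y = M := by
  obtain ⟨s, hs, hsU⟩ := Metric.isOpen_iff.1 hU y₀ hy₀
  -- Half the radius keeps the closed ball about `y₁` through `y₀` inside `U`.
  filter_upwards [Metric.ball_mem_nhds y₀ (half_pos hs)] with y₁ hy₁
  by_contra hne
  have huc : ∀ y ∈ U, ContinuousAt u y := fun y hy => (hu y hy).continuousAt
  have hD : Metric.closedBall y₁ (dist y₀ y₁) ⊆ U := by
    intro y hy
    apply hsU
    rw [Metric.mem_ball] at hy₁ ⊢
    rw [Metric.mem_closedBall, dist_comm y₀] at hy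
    linarith [dist_triangle y y₁ y₀]
  have hK : IsCompact (Metric.closedBall y₁ (dist y₀ y₁) ∩ u ⁻¹' {M}) := by
    have hcl := ContinuousOn.preimage_isClosed_of_isClosed
      (fun y hy => (huc y (hD hy)).continuousWithinAt) Metric.isClosed_closedBall
      (isClosed_singleton (x := M)) (f := u) (s := Metric.closedBall y₁ (dist y₀ y₁))
    exact (isCompact_closedBall _ _).of_isClosed_subset hcl Set.inter_subset_left
  -- A point of `{u = M}` nearest to `y₁`: the open ball about `y₁` reaching to `z` lies in `{u <
  -- M}`.
  obtain ⟨z, ⟨hzD, hzM⟩, hzmin⟩ := hK.exists_isMinOn ⟨y₀, Metric.mem_closedBall.2 le_rfl, h₀⟩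
    (continuous_id.dist continuous_const : Continuous fun y => dist y y₁).continuousOn
  have hzM : u z = M := hzM
  have hzU : z ∈ U := hD hzD
  set r := dist z y₁
  have hr : 0 < r := dist_pos.2 fun h => hne (h ▸ hzM)
  have hlt : ∀ y, dist y y₁ < r → u y < M := by
    intro y hy
    have hyD : y ∈ Metric.closedBall y₁ (dist y₀ y₁) := hy.le.trans hzD
    refine lt_of_le_of_ne (hM y (hD hyD)) fun h => ?_
    exact absurd (hzmin ⟨hyD, h⟩) (not_le.2 hy)
  -- The ball about this midpoint with half the radius is internally tangent at `z`, which leaves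
  -- `z` as the only contact point with `{u = M}` on its closure.
  set m : E := (1 / 2 : ℝ) • (y₁ + z)
  have hzm : ‖z - m‖ = r / 2 := by
    have : z - m = (1 / 2 : ℝ) • (z - y₁) := by simp only [m]; module
    rw [this, norm_smul, ← dist_eq_norm]
    norm_num
    ring
  have hball : ∀ y, ‖y - m‖ ≤ r / 2 → y ≠ z → u y < M := by
    intro y hy hyz
    apply hlt
    -- It gives `‖y - y₁‖² + ‖y - z‖² ≤ r²`, strict convexity of the ball in quantitative form.
    have hp := parallelogram_law_with_norm ℝ (y - m) (z - m)
    have e1 : y - m + (z - m) = y - y₁ := by simp only [m]; module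
    have e2 : y - m - (z - m) = y - z := by abel
    rw [e1, e2, hzm] at hp
    have h1 : 0 < ‖y - z‖ := norm_pos_iff.2 (sub_ne_zero.2 hyz)
    rw [dist_eq_norm]
    have h2 : 0 < ‖y - z‖ * ‖y - z‖ := by positivity
    have h3 : ‖y - m‖ * ‖y - m‖ ≤ r / 2 * (r / 2) := mul_self_le_mul_self (norm_nonneg _) hy
    exact lt_of_mul_self_lt_mul_self₀ hr.le (by linarith)
  obtain ⟨t, ht, htU⟩ := Metric.isOpen_iff.1 hU z hzU
  -- The bound `t / 2` keeps the ball about `z` in `U`; the bound `r / 4` keeps `m`, the critical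
  -- point of `q`, out of it.
  set δ := min (t / 2) (r / 4)
  have hδ : 0 < δ := lt_min (by linarith) (by linarith)
  have hδt : δ < t := (min_le_left _ _).trans_lt (by linarith)
  have hδr : δ < r / 2 := (min_le_right _ _).trans_lt (by linarith)
  have hBU : Metric.closedBall z δ ⊆ U := (Metric.closedBall_subset_ball hδt).trans htU
  set q : E → ℝ := fun y => ‖y - m‖ ^ 2
  have hq : ContDiff ℝ ∞ q := (contDiff_id.sub contDiff_const).norm_sq ℝ
  have hq0 : ∀ y ∈ Metric.closedBall z δ, fderiv ℝ q y ≠ 0 := by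
    intro y hy h
    have hd := ((hasFDerivAt_id (𝕜 := ℝ) y).sub_const m).norm_sq
    have hd' : fderiv ℝ q y = _ := hd.fderiv
    rw [hd'] at h
    have h1 : (2 • inner ℝ (y - m) (y - m) : ℝ) = 0 :=
      congrArg (fun L : E →L[ℝ] ℝ => L (y - m)) h
    rw [smul_eq_zero_iff_right two_ne_zero, inner_self_eq_zero, sub_eq_zero] at h1
    rw [h1, mem_closedBall_iff_norm, norm_sub_rev, hzm] at hy
    linarith
  obtain ⟨a, ha, hbar⟩ := exists_exp_barrier (isCompact_closedBall z δ)
    (fun y hy => hG y (hBU hy)) (fun y hy => hpos y (hBU hy)) (hX.mono hBU) hq hq0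
  set v : E → ℝ := fun y => Real.exp (-a * q y)
  have hv : ContDiff ℝ ∞ v := (contDiff_const.mul hq).exp
  have hv1 : ∀ y, v y ≤ 1 := fun y => by
    rw [Real.exp_le_one_iff]
    have : 0 ≤ a * q y := by positivity
    linarith
  -- On the compact cap of the sphere inside the tangent ball, `u` stays below `M` by a fixed gap.
  obtain ⟨ε, hε, hεS⟩ : ∃ ε : ℝ, 0 < ε ∧ ∀ y ∈ Metric.sphere z δ, ‖y - m‖ ≤ r / 2 →
      u y ≤ M - ε := by
    set T : Set E := Metric.sphere z δ ∩ Metric.closedBall m (r / 2)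
    have hT : IsCompact T := (isCompact_sphere z δ).inter_right Metric.isClosed_closedBall
    rcases T.eq_empty_or_nonempty with hTe | hTn
    · refine ⟨1, one_pos, fun y hy hy' => ?_⟩
      exact absurd (show y ∈ T from ⟨hy, mem_closedBall_iff_norm.2 hy'⟩) (hTe ▸ Set.notMem_empty y)
    · obtain ⟨y', ⟨hy'1, hy'2⟩, hy'⟩ := hT.exists_isMaxOn hTn fun y hy =>
        (huc y (hBU (Metric.sphere_subset_closedBall hy.1))).continuousWithinAt
      refine ⟨M - u y', sub_pos.2 (hball y' (mem_closedBall_iff_norm.1 hy'2) ?_), fun y hy hym => ?_⟩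
      · rintro rfl
        simp at hy'1
        linarith
      · have := hy' (show y ∈ T from ⟨hy, mem_closedBall_iff_norm.2 hym⟩)
        simp at this
        linarith
  -- On the cap the gap absorbs `ε v ≤ ε`. Off the cap `u ≤ M`, and `v` is smaller than at `z`
  -- because the point is farther from `m`.
  have hsphere : ∀ y ∈ Metric.sphere z δ, u y + ε * v y < u z + ε * v z := by
    intro y hy
    have hvz : 0 < ε * v z := mul_pos hε (Real.exp_pos _)
    rcases le_or_gt ‖y - m‖ (r / 2) with hy' | hy'
    · have := hεS y hy hy'
      have h2 : ε * v y ≤ ε * 1 := mul_le_mul_of_nonneg_left (hv1 y) hε.le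
      linarith
    · have h1 := hM y (hBU (Metric.sphere_subset_closedBall hy))
      have h2 : v y < v z := by
        apply Real.exp_lt_exp.2
        have h3 : q z < q y := by
          simp only [q]
          rw [hzm]
          exact pow_lt_pow_left₀ hy' (by positivity) two_ne_zero
        have := mul_lt_mul_of_pos_left h3 ha
        linarith
      have := mul_lt_mul_of_pos_left h2 hε
      linarith
  -- The perturbed function has an interior maximum, where `L(u + ε v) ≤ 0`, although `L u ≥ 0` and
  -- `L v > 0`.
  obtain ⟨p, hp, hpmax⟩ := (isCompact_closedBall z δ).exists_isMaxOn
    ⟨z, Metric.mem_closedBall_self hδ.le⟩ (f := fun y => u y + ε * v y) fun y hy =>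
      ((huc y (hBU hy)).add (continuousAt_const.mul hv.continuous.continuousAt)).continuousWithinAt
  have hpb : p ∈ Metric.ball z δ := by
    refine lt_of_le_of_ne (Metric.mem_closedBall.1 hp) fun h => ?_
    exact absurd (hpmax (Metric.mem_closedBall_self hδ.le)) (not_le.2 (hsphere p h))
  have hpU := hBU hp
  have hloc : IsLocalMax (fun y => u y + ε * v y) p :=
    hpmax.isLocalMax (Filter.mem_of_superset (Metric.isOpen_ball.mem_nhds hpb)
      Metric.ball_subset_closedBall)
  have hw : ContDiffAt ℝ ∞ (fun y => u y + ε * v y) p :=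
    (hu p hpU).add (contDiffAt_const.mul hv.contDiffAt)
  obtain ⟨e1, e2⟩ := metricLaplacian_add_smul (G := G) (hu p hpU) (hv.contDiffAt (x := p)) ε
  have hgrad := hloc.fderiv_eq_zero
  have hlap : metricLaplacian G (fun y => u y + ε * v y) p ≤ 0 := by
    refine metricTrace_nonpos (hpos p hpU) (hG p hpU).symm.self_of_nhds fun e => ?_
    rw [hessianForm_apply, localHessian, hgrad]
    simpa using fderiv_fderiv_nonpos_of_isLocalMax hw hloc e
  rw [e2] at hgrad
  have h3 := congrArg (fun L : E →L[ℝ] ℝ => L (X p)) hgrad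
  simp only [add_apply, smul_apply, smul_eq_mul, zero_apply] at h3
  have h4 := hL p hpU
  have h5 := mul_pos hε (hbar p hp)
  rw [e1] at hlap
  linarith

end MaximumPrinciple

/-! ### Charts of a manifold and invariance under chart changes. -/

section MetricInCharts

variable {E : Type*} [NormedAddCommGroup E] [NormedSpace ℝ E] [FiniteDimensional ℝ E]
  {H : Type*} [TopologicalSpace H] {I : ModelWithCorners ℝ E H} [I.Boundaryless]
  {M : Type*} [TopologicalSpace M] [ChartedSpace H M] [IsManifold I ∞ M]

/-- The derivative of the inverse of a chart, on the model space. -/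
noncomputable def chartSymmDeriv (I : ModelWithCorners ℝ E H) {M : Type*} [TopologicalSpace M]
    [ChartedSpace H M] (x₀ : M) (y : E) : E →L[ℝ] E :=
  mfderiv 𝓘(ℝ, E) I (extChartAt I x₀).symm y

theorem isInvertible_chartSymmDeriv (x₀ : M) {y : E} (hy : y ∈ (extChartAt I x₀).target) :
    (chartSymmDeriv I x₀ y).IsInvertible := by
  have : IsManifold I 1 M := IsManifold.of_le (n := ∞) (by simp)
  have h := isInvertible_mfderivWithin_extChartAt_symm (I := I) hy
  rw [I.range_eq_univ, mfderivWithin_univ] at h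
  exact h

theorem metricInChart_apply (g : ∀ x : M, TangentSpace I x →L[ℝ] TangentSpace I x →L[ℝ] ℝ)
    (x₀ : M) (y v w : E) :
    metricInChart I g x₀ y v w = (g ((extChartAt I x₀).symm y) : E →L[ℝ] E →L[ℝ] ℝ)
      (chartSymmDeriv I x₀ y v) (chartSymmDeriv I x₀ y w) := rfl

namespace SemiRiemannianMetric

theorem metricInChart_symm (g : SemiRiemannianMetric I M) (x₀ : M) (z v w : E) :
    metricInChart I g.toFun x₀ z v w = metricInChart I g.toFun x₀ z w v := by
  rw [metricInChart_apply, metricInChart_apply]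
  exact g.symm ((extChartAt I x₀).symm z) (chartSymmDeriv I x₀ z v) (chartSymmDeriv I x₀ z w)

theorem isInvertible_metricInChart (g : SemiRiemannianMetric I M) (x₀ : M) {z : E}
    (hz : z ∈ (extChartAt I x₀).target) : (metricInChart I g.toFun x₀ z).IsInvertible := by
  have hA := isInvertible_chartSymmDeriv (I := I) x₀ hz
  refine isInvertible_of_nondegenerate fun v hv => ?_
  have h : chartSymmDeriv I x₀ z v = 0 := by
    refine g.nondegenerate ((extChartAt I x₀).symm z) (chartSymmDeriv I x₀ z v)
      fun (w : E) => ?_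
    obtain ⟨w', rfl⟩ := hA.surjective w
    exact hv w'
  exact hA.injective (h.trans (map_zero _).symm)

theorem isLocalMetric_metricInChart (g : SemiRiemannianMetric I M) (x₀ : M) {y : E}
    (hy : y ∈ (extChartAt I x₀).target) : IsLocalMetric (metricInChart I g.toFun x₀) y where
  smooth := by
    filter_upwards [(isOpen_extChartAt_target x₀).mem_nhds hy] with z hz
    exact (g.smooth x₀).contDiffAt ((isOpen_extChartAt_target x₀).mem_nhds hz)
  invertible := by
    filter_upwards [(isOpen_extChartAt_target x₀).mem_nhds hy] with z hz
    exact g.isInvertible_metricInChart x₀ hz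
  symm := Eventually.of_forall (g.metricInChart_symm x₀)

theorem IsRiemannian.metricInChart_pos {g : SemiRiemannianMetric I M} (hg : g.IsRiemannian)
    (x₀ : M) {y : E} (hy : y ∈ (extChartAt I x₀).target) (v : E) (hv : v ≠ 0) :
    0 < metricInChart I g.toFun x₀ y v v := by
  refine hg _ _ fun h => hv ((isInvertible_chartSymmDeriv (I := I) x₀ hy).injective ?_)
  rw [map_zero]
  exact h

end SemiRiemannianMetric

/-- The coordinate change from the preferred chart at `x₀` to that at `x`. -/
noncomputable def chartTransition (I : ModelWithCorners ℝ E H) {M : Type*} [TopologicalSpace M]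
    [ChartedSpace H M] (x₀ x : M) : E → E := extChartAt I x ∘ (extChartAt I x₀).symm

theorem contDiffAt_chartTransition (x₀ x : M) {z : E} (hz : z ∈ (extChartAt I x₀).target)
    (hz' : (extChartAt I x₀).symm z ∈ (extChartAt I x).source) :
    ContDiffAt ℝ ∞ (chartTransition I x₀ x) z := by
  rw [← contMDiffAt_iff_contDiffAt]
  have h1 : ContMDiffAt 𝓘(ℝ, E) I ∞ (extChartAt I x₀).symm z :=
    (contMDiffOn_extChartAt_symm x₀).contMDiffAt ((isOpen_extChartAt_target x₀).mem_nhds hz)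
  have h2 : ContMDiffAt I 𝓘(ℝ, E) ∞ (extChartAt I x) ((extChartAt I x₀).symm z) :=
    contMDiffAt_extChartAt' (by rwa [extChartAt_source] at hz')
  exact h2.comp z h1

theorem eventually_mem_overlap (x₀ x : M) {z : E} (hz : z ∈ (extChartAt I x₀).target)
    (hz' : (extChartAt I x₀).symm z ∈ (extChartAt I x).source) :
    ∀ᶠ y in 𝓝 z, y ∈ (extChartAt I x₀).target ∧
      (extChartAt I x₀).symm y ∈ (extChartAt I x).source :=
  ((isOpen_extChartAt_target x₀).eventually_mem hz).and
    ((continuousAt_extChartAt_symm'' hz).eventually ((isOpen_extChartAt_source x).mem_nhds hz'))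

/-- Near `z` the inverse chart at `x₀` is the inverse chart at `x` after the transition map; apply
the chain rule. -/
theorem metricInChart_eq_pullback
    (g : ∀ x : M, TangentSpace I x →L[ℝ] TangentSpace I x →L[ℝ] ℝ) (x₀ x : M) {z : E}
    (hz : z ∈ (extChartAt I x₀).target)
    (hz' : (extChartAt I x₀).symm z ∈ (extChartAt I x).source) :
    metricInChart I g x₀ z = (metricInChart I g x (chartTransition I x₀ x z)).bilinearComp
      (fderiv ℝ (chartTransition I x₀ x) z) (fderiv ℝ (chartTransition I x₀ x) z) := by
  have : IsManifold I 1 M := IsManifold.of_le (n := ∞) (by simp)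
  have hφt : chartTransition I x₀ x z ∈ (extChartAt I x).target := (extChartAt I x).map_source hz'
  have h1 : MDifferentiableAt 𝓘(ℝ, E) 𝓘(ℝ, E) (chartTransition I x₀ x) z :=
    ((contDiffAt_chartTransition x₀ x hz hz').differentiableAt (by simp)).mdifferentiableAt
  have h2 : MDifferentiableAt 𝓘(ℝ, E) I (extChartAt I x).symm (chartTransition I x₀ x z) := by
    have := mdifferentiableWithinAt_extChartAt_symm (I := I) hφt
    rwa [I.range_eq_univ, mdifferentiableWithinAt_univ] at this
  have h3 : (extChartAt I x).symm ∘ chartTransition I x₀ x =ᶠ[𝓝 z] (extChartAt I x₀).symm := by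
    filter_upwards [eventually_mem_overlap x₀ x hz hz'] with y hy
    exact (extChartAt I x).left_inv hy.2
  have h4 : chartSymmDeriv I x₀ z
      = chartSymmDeriv I x (chartTransition I x₀ x z) ∘L fderiv ℝ (chartTransition I x₀ x) z := by
    have h5 := mfderiv_comp z h2 h1
    rw [mfderiv_eq_fderiv] at h5
    exact (h3.mfderiv_eq (I := 𝓘(ℝ, E)) (I' := I)).symm.trans h5
  ext v w
  rw [ContinuousLinearMap.bilinearComp_apply, metricInChart_apply, metricInChart_apply, h4]
  exact congrArg (fun m : M => (g m : E →L[ℝ] E →L[ℝ] ℝ) _ _) h3.self_of_nhds.symm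

theorem contDiffAt_comp_extChartAt_symm {f : M → ℝ} (hf : ContMDiff I 𝓘(ℝ, ℝ) ∞ f) (x₀ : M) {y : E}
    (hy : y ∈ (extChartAt I x₀).target) : ContDiffAt ℝ ∞ (f ∘ (extChartAt I x₀).symm) y :=
  (hf.comp_contMDiffOn (contMDiffOn_extChartAt_symm x₀)).contDiffOn.contDiffAt
    ((isOpen_extChartAt_target x₀).mem_nhds hy)

section Invariance

variable {y : E}

/-- A vector killed by the derivative of the transition lies in the radical of the pulled-back
metric, which is nondegenerate. -/
theorem SemiRiemannianMetric.isInvertible_fderiv_chartTransition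
    (g : SemiRiemannianMetric I M) (x₀ x : M)
    (hy : y ∈ (extChartAt I x₀).target) (hy' : (extChartAt I x₀).symm y ∈ (extChartAt I x).source) :
    (fderiv ℝ (chartTransition I x₀ x) y).IsInvertible := by
  refine isInvertible_of_injective fun v hv => ?_
  apply (g.isLocalMetric_metricInChart x₀ hy).isInvertible.injective
  ext w
  rw [metricInChart_eq_pullback g.toFun x₀ x hy hy', ContinuousLinearMap.bilinearComp_apply, hv]
  simp only [map_zero, zero_apply]

/-- Together with `gradProd_chart_eq`, this carries an inequality known at chart centres to all
points of one fixed chart. -/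
theorem SemiRiemannianMetric.metricLaplacian_chart_eq (g : SemiRiemannianMetric I M)
    (x₀ : M) {f : M → ℝ} (hf : ContMDiff I 𝓘(ℝ, ℝ) ∞ f)
    (x : M) (hy : y ∈ (extChartAt I x₀).target)
    (hy' : (extChartAt I x₀).symm y ∈ (extChartAt I x).source) :
    metricLaplacian (metricInChart I g.toFun x₀) (f ∘ (extChartAt I x₀).symm) y
      = metricLaplacian (metricInChart I g.toFun x) (f ∘ (extChartAt I x).symm)
        (chartTransition I x₀ x y) := by
  have hφt : chartTransition I x₀ x y ∈ (extChartAt I x).target := (extChartAt I x).map_source hy'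
  have hx := g.isLocalMetric_metricInChart x hφt
  have h0 := g.isLocalMetric_metricInChart x₀ hy
  refine metricLaplacian_pullback (contDiffAt_chartTransition x₀ x hy hy') hx.differentiableAt
    hx.isInvertible hx.symm h0.differentiableAt h0.isInvertible
    (g.isInvertible_fderiv_chartTransition x₀ x hy hy') ?_
    (contDiffAt_comp_extChartAt_symm hf x hφt) ?_
  · filter_upwards [eventually_mem_overlap x₀ x hy hy'] with z hz
      using metricInChart_eq_pullback g.toFun x₀ x hz.1 hz.2
  · filter_upwards [eventually_mem_overlap x₀ x hy hy'] with z hz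
    exact congrArg f ((extChartAt I x).left_inv hz.2).symm

theorem SemiRiemannianMetric.gradProd_chart_eq (g : SemiRiemannianMetric I M)
    (x₀ : M) {f h : M → ℝ} (hf : ContMDiff I 𝓘(ℝ, ℝ) ∞ f)
    (hh : ContMDiff I 𝓘(ℝ, ℝ) ∞ h)
    (x : M) (hy : y ∈ (extChartAt I x₀).target)
    (hy' : (extChartAt I x₀).symm y ∈ (extChartAt I x).source) :
    gradProd (metricInChart I g.toFun x₀) (f ∘ (extChartAt I x₀).symm)
        (h ∘ (extChartAt I x₀).symm) y
      = gradProd (metricInChart I g.toFun x) (f ∘ (extChartAt I x).symm)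
        (h ∘ (extChartAt I x).symm) (chartTransition I x₀ x y) := by
  have hφt : chartTransition I x₀ x y ∈ (extChartAt I x).target := (extChartAt I x).map_source hy'
  refine gradProd_pullback ((contDiffAt_chartTransition x₀ x hy hy').differentiableAt (by simp))
    (g.isLocalMetric_metricInChart x hφt).isInvertible
    (g.isLocalMetric_metricInChart x₀ hy).isInvertible
    (g.isInvertible_fderiv_chartTransition x₀ x hy hy')
    (metricInChart_eq_pullback g.toFun x₀ x hy hy')
    ((contDiffAt_comp_extChartAt_symm hf x hφt).differentiableAt (by simp)) ?_
    ((contDiffAt_comp_extChartAt_symm hh x hφt).differentiableAt (by simp)) ?_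
  · filter_upwards [eventually_mem_overlap x₀ x hy hy'] with z hz
    exact congrArg f ((extChartAt I x).left_inv hz.2).symm
  · filter_upwards [eventually_mem_overlap x₀ x hy hy'] with z hz
    exact congrArg h ((extChartAt I x).left_inv hz.2).symm

end Invariance

end MetricInCharts

/-! ### The warped product in product charts. -/

section WarpedInCharts

variable {E : Type*} [NormedAddCommGroup E] [NormedSpace ℝ E] [FiniteDimensional ℝ E]
  {E' : Type*} [NormedAddCommGroup E'] [NormedSpace ℝ E'] [FiniteDimensional ℝ E']
  {H : Type*} [TopologicalSpace H] {I : ModelWithCorners ℝ E H} [I.Boundaryless]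
  {H' : Type*} [TopologicalSpace H'] {J : ModelWithCorners ℝ E' H'} [J.Boundaryless]
  {B : Type*} [TopologicalSpace B] [ChartedSpace H B] [IsManifold I ∞ B]
  {F : Type*} [TopologicalSpace F] [ChartedSpace H' F] [IsManifold J ∞ F]

theorem metricInChart_warpedForm (gB : SemiRiemannianMetric I B) (gF : SemiRiemannianMetric J F)
    (f : B → ℝ) (p : B × F) {y : E × E'} (hy : y ∈ (extChartAt (I.prod J) p).target) :
    metricInChart (I.prod J) (warpedForm gB gF f) p y
      = prodForm (metricInChart I gB.toFun p.1 y.1)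
        ((f ∘ (extChartAt I p.1).symm) y.1 ^ 2 • metricInChart J gF.toFun p.2 y.2) := by
  refine ContinuousLinearMap.ext fun v => ContinuousLinearMap.ext fun w => ?_
  have hs : (extChartAt (I.prod J) p).symm y
      = ((extChartAt I p.1).symm y.1, (extChartAt J p.2).symm y.2) := by
    rw [extChartAt_prod]; rfl
  have hv := mfderiv_extChartAt_symm_prod (I := I) (J := J) p hy v
  have hw := mfderiv_extChartAt_symm_prod (I := I) (J := J) p hy w
  change warpedForm gB gF f ((extChartAt (I.prod J) p).symm y)
    (mfderiv 𝓘(ℝ, E × E') (I.prod J) (extChartAt (I.prod J) p).symm y v : E × E')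
    (mfderiv 𝓘(ℝ, E × E') (I.prod J) (extChartAt (I.prod J) p).symm y w : E × E') = _
  rw [hv, hw, hs]
  rfl

theorem isLocalWarpedProduct_metricInChart (gB : SemiRiemannianMetric I B)
    (gF : SemiRiemannianMetric J F) {f : B → ℝ} (hf : ContMDiff I 𝓘(ℝ, ℝ) ∞ f)
    (hpos : ∀ x, 0 < f x) (p : B × F) :
    IsLocalWarpedProduct (metricInChart (I.prod J) (warpedForm gB gF f) p)
      (metricInChart I gB.toFun p.1) (metricInChart J gF.toFun p.2)
      (f ∘ (extChartAt I p.1).symm) (extChartAt I p.1 p.1, extChartAt J p.2 p.2) where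
  base := gB.isLocalMetric_metricInChart p.1 (mem_extChartAt_target p.1)
  fiber := gF.isLocalMetric_metricInChart p.2 (mem_extChartAt_target p.2)
  smooth := by
    filter_upwards [(isOpen_extChartAt_target p.1).mem_nhds (mem_extChartAt_target p.1)] with z hz
    exact contDiffAt_comp_extChartAt_symm hf p.1 hz
  -- Positivity of `f` on all of `B` covers even the values of the inverse chart outside its target.
  ne_zero := Eventually.of_forall fun z => (hpos _).ne'
  eq := by
    have hm : (extChartAt I p.1 p.1, extChartAt J p.2 p.2) ∈ (extChartAt (I.prod J) p).target := by
      rw [extChartAt_prod]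
      exact ⟨mem_extChartAt_target p.1, mem_extChartAt_target p.2⟩
    filter_upwards [(isOpen_extChartAt_target (I := I.prod J) p).mem_nhds hm] with z hz
    exact metricInChart_warpedForm gB gF f p hz

end WarpedInCharts

theorem gradProd_comm {E : Type*} [NormedAddCommGroup E] [NormedSpace ℝ E]
    {G : E → E →L[ℝ] E →L[ℝ] ℝ} {y : E} (hG : (G y).IsInvertible)
    (hs : ∀ v w, G y v w = G y w v) (u v : E → ℝ) : gradProd G u v y = gradProd G v u y := by
  have h : ∀ a b : E → ℝ, gradProd G a b y
      = G y ((G y).inverse (fderiv ℝ a y)) ((G y).inverse (fderiv ℝ b y)) := by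
    intro a b
    rw [hG.self_apply_inverse]
    rfl
  rw [h, h, hs]

/-! ### The soliton equation and the inequality for the warping function. -/

section Solitons

variable {E : Type*} [NormedAddCommGroup E] [NormedSpace ℝ E] [FiniteDimensional ℝ E]
  {E' : Type*} [NormedAddCommGroup E'] [NormedSpace ℝ E'] [FiniteDimensional ℝ E']
  {H : Type*} [TopologicalSpace H] {I : ModelWithCorners ℝ E H} [I.Boundaryless]
  {H' : Type*} [TopologicalSpace H'] {J : ModelWithCorners ℝ E' H'} [J.Boundaryless]
  {B : Type*} [TopologicalSpace B] [ChartedSpace H B] [IsManifold I ∞ B]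
  {F : Type*} [TopologicalSpace F] [ChartedSpace H' F] [IsManifold J ∞ F]

/-- The scalar curvature of a warped product, in the preferred charts. -/
theorem scalarCurvature_warpedProduct (gB : SemiRiemannianMetric I B)
    (gF : SemiRiemannianMetric J F) {f : B → ℝ} (hf : ContMDiff I 𝓘(ℝ, ℝ) ∞ f)
    (hpos : ∀ x, 0 < f x) (x : B) (y : F) :
    (gB.warpedProduct gF f hf hpos).scalarCurvature (x, y)
      = gB.scalarCurvature x + gF.scalarCurvature y / f x ^ 2
        - 2 * Module.finrank ℝ E' * metricLaplacian (metricInChart I gB.toFun x)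
          (f ∘ (extChartAt I x).symm) (extChartAt I x x) / f x
        - Module.finrank ℝ E' * (Module.finrank ℝ E' - 1)
          * gradProd (metricInChart I gB.toFun x) (f ∘ (extChartAt I x).symm)
            (f ∘ (extChartAt I x).symm) (extChartAt I x x) / f x ^ 2 := by
  have h := (isLocalWarpedProduct_metricInChart gB gF hf hpos (x, y)).localScalarCurvature_eq
  have e : extChartAt (I.prod J) (x, y) (x, y) = (extChartAt I x x, extChartAt J y y) := by
    rw [extChartAt_prod]; rfl
  have e' : (f ∘ (extChartAt I x).symm) (extChartAt I x x) = f x := by simp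
  simp only [e'] at h
  rw [SemiRiemannianMetric.scalarCurvature, e]
  exact h

/-- The Hessian of a function on the base of a warped product along the fibre. -/
theorem hessian_warpedProduct_vertical (gB : SemiRiemannianMetric I B)
    (gF : SemiRiemannianMetric J F) {f : B → ℝ} (hf : ContMDiff I 𝓘(ℝ, ℝ) ∞ f)
    (hpos : ∀ x, 0 < f x) {h : B → ℝ} (hh : ContMDiff I 𝓘(ℝ, ℝ) ∞ h) (x : B) (y : F) (b c : E') :
    (gB.warpedProduct gF f hf hpos).hessian (fun p : B × F => h p.1) (x, y)
        ((0, b) : E × E') ((0, c) : E × E')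
      = f x * (gF.toFun y : E' →L[ℝ] E' →L[ℝ] ℝ) b c
        * gradProd (metricInChart I gB.toFun x) (h ∘ (extChartAt I x).symm)
          (f ∘ (extChartAt I x).symm) (extChartAt I x x) := by
  have hw := isLocalWarpedProduct_metricInChart gB gF hf hpos (x, y)
  have e : extChartAt (I.prod J) (x, y) (x, y) = (extChartAt I x x, extChartAt J y y) := by
    rw [extChartAt_prod]; rfl
  have e' : (f ∘ (extChartAt I x).symm) (extChartAt I x x) = f x := by simp
  have hu : (fun p : B × F => h p.1) ∘ (extChartAt (I.prod J) (x, y)).symm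
      = fun q => (h ∘ (extChartAt I x).symm) q.1 := by
    rw [extChartAt_prod]; rfl
  have h1 := hw.localHessian_vertical
    (contDiffAt_comp_extChartAt_symm hh x (mem_extChartAt_target x))
    (EventuallyEq.of_eq hu) b c
  simp only [e'] at h1
  -- At its centre the preferred chart identifies the tangent space with `E'`, so the local form is
  -- the metric itself.
  have h2 : metricInChart J gF.toFun y (extChartAt J y y) b c
      = (gF.toFun y : E' →L[ℝ] E' →L[ℝ] ℝ) b c := metricInChart_self gF.toFun y b c
  rw [h2] at h1
  change localHessian (metricInChart (I.prod J) (warpedForm gB gF f) (x, y))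
    ((fun p : B × F => h p.1) ∘ (extChartAt (I.prod J) (x, y)).symm)
    (extChartAt (I.prod J) (x, y) (x, y)) (0, b) (0, c) = _
  rw [e]
  exact h1

/-- The fibre metric may be indefinite, so a pair of vectors is chosen and not the square of a
single one. The fibre must have positive dimension. -/
theorem SemiRiemannianMetric.exists_ne_zero (hd : 1 ≤ Module.finrank ℝ E')
    (gF : SemiRiemannianMetric J F) (y : F) :
    ∃ b c : E', (gF.toFun y : E' →L[ℝ] E' →L[ℝ] ℝ) b c ≠ 0 := by
  have : Nontrivial E' := Module.nontrivial_of_finrank_pos hd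
  obtain ⟨b, hb⟩ := exists_ne (0 : E')
  by_contra! hcon
  exact hb (gF.nondegenerate y b fun w => hcon b w)

/-- On a gradient Yamabe soliton the potential determines the scalar curvature of the warped
product. -/
theorem scalarCurvature_sub_eq_of_isGradientYamabeSoliton (hd : 1 ≤ Module.finrank ℝ E')
    (gB : SemiRiemannianMetric I B)
    (gF : SemiRiemannianMetric J F) {f : B → ℝ} (hf : ContMDiff I 𝓘(ℝ, ℝ) ∞ f)
    (hpos : ∀ x, 0 < f x) {h : B → ℝ} (hh : ContMDiff I 𝓘(ℝ, ℝ) ∞ h) {ρ : ℝ}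
    (hsol : (gB.warpedProduct gF f hf hpos).IsGradientYamabeSoliton (fun p : B × F => h p.1) ρ)
    (x : B) (y : F) :
    f x * ((gB.warpedProduct gF f hf hpos).scalarCurvature (x, y) - ρ)
      = gradProd (metricInChart I gB.toFun x) (h ∘ (extChartAt I x).symm)
          (f ∘ (extChartAt I x).symm) (extChartAt I x x) := by
  obtain ⟨b, c, hbc⟩ := gF.exists_ne_zero hd y
  have h1 := hsol.2 (x, y) ((0, b) : E × E') ((0, c) : E × E')
  rw [hessian_warpedProduct_vertical gB gF hf hpos hh x y b c] at h1
  have h2 : (gB.warpedProduct gF f hf hpos).toFun (x, y) ((0, b) : E × E') ((0, c) : E × E')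
      = f x ^ 2 * (gF.toFun y : E' →L[ℝ] E' →L[ℝ] ℝ) b c := by
    refine (warpedForm_apply gB gF f (x, y) ((0, b) : E × E') ((0, c) : E × E')).trans ?_
    have h3 : (gB.toFun x : E →L[ℝ] E →L[ℝ] ℝ) 0 0 = 0 := map_zero _
    exact (congrArg (· + _) h3).trans (zero_add _)
  rw [h2] at h1
  have hf0 := (hpos x).ne'
  apply mul_left_cancel₀ (mul_ne_zero hf0 hbc)
  linear_combination h1

/-- The differential inequality satisfied by the warping function, in the chart at the point. -/
theorem warping_inequality (hd : 1 ≤ Module.finrank ℝ E') (gB : SemiRiemannianMetric I B)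
    (gF : SemiRiemannianMetric J F) {f : B → ℝ} (hf : ContMDiff I 𝓘(ℝ, ℝ) ∞ f)
    (hpos : ∀ x, 0 < f x) {h : B → ℝ} (hh : ContMDiff I 𝓘(ℝ, ℝ) ∞ h) {ρ : ℝ}
    (hsol : (gB.warpedProduct gF f hf hpos).IsGradientYamabeSoliton (fun p : B × F => h p.1) ρ)
    (x : B) (y : F) (hS : ρ - gF.scalarCurvature y / f x ^ 2 ≤ gB.scalarCurvature x) :
    0 ≤ metricLaplacian (metricInChart I gB.toFun x) (f ∘ (extChartAt I x).symm) (extChartAt I x x)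
      + (Module.finrank ℝ E' - 1) / 2 / f x
          * gradProd (metricInChart I gB.toFun x) (f ∘ (extChartAt I x).symm)
            (f ∘ (extChartAt I x).symm) (extChartAt I x x)
      + 1 / (2 * Module.finrank ℝ E')
          * gradProd (metricInChart I gB.toFun x) (h ∘ (extChartAt I x).symm)
            (f ∘ (extChartAt I x).symm) (extChartAt I x x) := by
  have h1 := scalarCurvature_sub_eq_of_isGradientYamabeSoliton hd gB gF hf hpos hh hsol x y
  rw [scalarCurvature_warpedProduct] at h1
  rw [← h1]
  have hfx := hpos x
  have hd' : (0 : ℝ) < Module.finrank ℝ E' := by exact_mod_cast hd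
  -- This multiple of the curvature excess is exactly the differential expression, once `⟨∇h, ∇f⟩`
  -- is replaced through the soliton equation.
  have h2 : 0 ≤ f x / (2 * Module.finrank ℝ E')
      * (gB.scalarCurvature x + gF.scalarCurvature y / f x ^ 2 - ρ) :=
    mul_nonneg (by positivity) (by linarith)
  refine h2.trans_eq ?_
  field_simp
  ring

end Solitons

/-- A smooth function on a connected Riemannian manifold that attains its maximum and satisfies, in
the preferred chart at every point, a differential inequality `Δf + a(f) |∇f|² + b ⟨∇h, ∇f⟩ ≥ 0`,
is constant. -/
theorem eq_of_laplacian_inequality {E : Type*} [NormedAddCommGroup E] [InnerProductSpace ℝ E]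
    [FiniteDimensional ℝ E] {H : Type*} [TopologicalSpace H] {I : ModelWithCorners ℝ E H}
    [I.Boundaryless] {B : Type*} [TopologicalSpace B] [ChartedSpace H B] [IsManifold I ∞ B]
    [ConnectedSpace B] {g : SemiRiemannianMetric I B} (hg : g.IsRiemannian) {f h : B → ℝ}
    (hf : ContMDiff I 𝓘(ℝ, ℝ) ∞ f) (hh : ContMDiff I 𝓘(ℝ, ℝ) ∞ h) (hpos : ∀ x, 0 < f x) (a b : ℝ)
    (hL : ∀ x, 0 ≤ metricLaplacian (metricInChart I g.toFun x) (f ∘ (extChartAt I x).symm)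
        (extChartAt I x x)
      + a / f x * gradProd (metricInChart I g.toFun x) (f ∘ (extChartAt I x).symm)
            (f ∘ (extChartAt I x).symm) (extChartAt I x x)
      + b * gradProd (metricInChart I g.toFun x) (h ∘ (extChartAt I x).symm)
            (f ∘ (extChartAt I x).symm) (extChartAt I x x))
    {x₀ : B} (hmax : ∀ x, f x ≤ f x₀) (x : B) : f x = f x₀ := by
  have hclosed : IsClosed {x | f x = f x₀} := isClosed_eq hf.continuous continuous_const
  have hopen : IsOpen {x | f x = f x₀} := by
    rw [isOpen_iff_mem_nhds]
    intro x₁ hx₁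
    set φ := extChartAt I x₁
    set G := metricInChart I g.toFun x₁
    set u := f ∘ φ.symm
    set w := h ∘ φ.symm
    -- Freezing the coefficients turns the quadratic term `(a / u) |∇u|²` into a linear drift
    -- `Du(X)`.
    set X : E → E := fun z => (a / u z) • metricGradient G u z + b • metricGradient G w z
    have hG : ∀ z ∈ φ.target, IsLocalMetric G z := fun z hz => g.isLocalMetric_metricInChart x₁ hz
    have hu : ∀ z ∈ φ.target, ContDiffAt ℝ ∞ u z := fun z hz =>
      contDiffAt_comp_extChartAt_symm hf x₁ hz
    have hw : ∀ z ∈ φ.target, ContDiffAt ℝ ∞ w z := fun z hz =>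
      contDiffAt_comp_extChartAt_symm hh x₁ hz
    have hX : ContinuousOn X φ.target := fun z hz => by
      refine ContinuousAt.continuousWithinAt (ContinuousAt.add (ContinuousAt.smul ?_ ?_)
        (ContinuousAt.const_smul ?_ b))
      · exact continuousAt_const.div (hu z hz).continuousAt (hpos _).ne'
      · exact (differentiableAt_metricGradient (hG z hz) (hu z hz)).continuousAt
      · exact (differentiableAt_metricGradient (hG z hz) (hw z hz)).continuousAt
    have hLu : ∀ z ∈ φ.target, 0 ≤ metricLaplacian G u z + fderiv ℝ u z (X z) := by
      intro z hz
      have hz' : φ.symm z ∈ (extChartAt I (φ.symm z)).source := mem_extChartAt_source _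
      have h1 := hL (φ.symm z)
      have e : extChartAt I (φ.symm z) (φ.symm z) = chartTransition I x₁ (φ.symm z) z := rfl
      -- The hypothesis lives in the chart centred at the point; chart invariance moves it to the
      -- chart at `x₁`.
      rw [e, ← g.metricLaplacian_chart_eq x₁ hf (φ.symm z) hz hz',
        ← g.gradProd_chart_eq x₁ hf hf (φ.symm z) hz hz',
        ← g.gradProd_chart_eq x₁ hh hf (φ.symm z) hz hz',
        gradProd_comm (hG z hz).isInvertible (hG z hz).symm.self_of_nhds w u] at h1
      refine h1.trans_eq ?_
      simp only [X, map_add, map_smul, smul_eq_mul]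
      rw [← add_assoc]
      rfl
    have hloc := eventually_eq_of_metricLaplacian_nonneg (isOpen_extChartAt_target x₁) hG
      (fun z hz => hg.metricInChart_pos x₁ hz) hu hX hLu (fun z _ => hmax (φ.symm z))
      (mem_extChartAt_target x₁) ((congrArg f (extChartAt_to_inv x₁)).trans hx₁)
    filter_upwards [(continuousAt_extChartAt x₁).eventually hloc,
      extChartAt_source_mem_nhds (I := I) x₁] with z hz hz'
    rw [← φ.left_inv hz']
    exact hz
  have huniv := IsClopen.eq_univ ⟨hclosed, hopen⟩ ⟨x₀, rfl⟩
  exact Set.eq_univ_iff_forall.1 huniv x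

theorem mainTheorem2 {n d : ℕ} (hd : 1 ≤ d)
    {B : Type*} [TopologicalSpace B] [ChartedSpace (EuclideanSpace ℝ (Fin n)) B]
    [IsManifold (𝓡 n) ∞ B] [ConnectedSpace B]
    {F : Type*} [TopologicalSpace F] [ChartedSpace (EuclideanSpace ℝ (Fin d)) F]
    [IsManifold (𝓡 d) ∞ F] [Nonempty F]
    (gB : SemiRiemannianMetric (𝓡 n) B) (hgB : gB.IsRiemannian)
    (gF : SemiRiemannianMetric (𝓡 d) F)
    (f : B → ℝ) (hf : ContMDiff (𝓡 n) 𝓘(ℝ, ℝ) ∞ f) (hpos : ∀ x, 0 < f x)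
    (h : B → ℝ) (hh : ContMDiff (𝓡 n) 𝓘(ℝ, ℝ) ∞ h) (ρ lamF : ℝ)
    (hlamF : ∀ y, gF.scalarCurvature y = lamF)
    (hsol : (gB.warpedProduct gF f hf hpos).IsGradientYamabeSoliton
      (fun p : B × F => h p.1) ρ)
    (hS : ∀ x, ρ - lamF / f x ^ 2 ≤ gB.scalarCurvature x)
    (hmax : ∃ x₀, ∀ x, f x ≤ f x₀) :
    ∃ (c : ℝ) (hc : 0 < c), (∀ x, f x = c) ∧
      gB.warpedProduct gF f hf hpos = gB.prod (gF.scale c hc) := by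
  obtain ⟨x₀, hx₀⟩ := hmax
  -- A single point of the fibre suffices, since the inequality for `f` involves the fibre only
  -- through its constant scalar curvature.
  obtain ⟨y⟩ := ‹Nonempty F›
  have hd' : 1 ≤ Module.finrank ℝ (EuclideanSpace ℝ (Fin d)) := by simpa using hd
  have hconst : ∀ x, f x = f x₀ := eq_of_laplacian_inequality hgB hf hh hpos _ _
    (fun x => warping_inequality hd' gB gF hf hpos hh hsol x y (by rw [hlamF]; exact hS x)) hx₀
  refine ⟨f x₀, hpos x₀, hconst, SemiRiemannianMetric.ext (funext fun p => ?_)⟩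
  refine ContinuousLinearMap.ext fun v => ContinuousLinearMap.ext fun w => ?_
  rw [SemiRiemannianMetric.prod_apply]
  refine (warpedForm_apply gB gF f p v w).trans ?_
  rw [hconst p.1]
  rfl
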